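/- Let $n,k\in\mathbb{N}$ and $m\in\{0,1,2\}$ with $k\ge 2+\lfloor n/2\rfloor$. Let $\Omega\subseteq\mathbb{R}^n$ be an extension domain, i.e. an open set for which there is a bounded linear operator $E:H^k(\Omega)\to H^k(\mathbb{R}^n)$ with $Eu=u$ a.e. in $\Omega$ for all $u\in H^k(\Omega)$. Let $f\in C^{k+1+m}_b(\mathbb{R}^n;\mathbb{R}^n)$, i.e. $f:\mathbb{R}^n\to\mathbb{R}^n$ is $k+1+m$ times continuously differentiable, and $f$ and all its derivatives of order at most $k+1+m$ are bounded; if $\Omega$ has infinite Lebesgue measure, assume moreover that $f(0)=0$. Then $f\circ u\in H^k(\Omega;\mathbb{R}^n)$ for every $u\in H^k(\Omega;\mathbb{R}^n)$, and the map $\Lambda_f:H^k(\Omega;\mathbb{R}^n)\to H^k(\Omega;\mathbb{R}^n)$, $\Lambda_f(u)=f\circ u$, is $C^m$ (continuous if $m=0$, and $m$ times continuously Fréchet differentiable if $m\ge1$). Here $H^k(\Omega;V)$ is the space of $u\in L^2(\Omega;V)$ whose weak partial derivatives of all orders $j\le k$ lie in $L^2(\Omega;V)$, with the norm $\|u\|_{H^k}^2=\sum_{j=0}^k\sum_{i_1,\dots,i_j=1}^n\|\partial_{i_1}\cdots\partial_{i_j}u\|_{L^2}^2$,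 and $H^k(\Omega)=H^k(\Omega;\mathbb{R})$. -/

import Mathlib

open MeasureTheory TopologicalSpace
open scoped ENNReal Distributions

noncomputable section

namespace SobolevComp

/-- `n`-dimensional real Euclidean space. -/
abbrev Euc (n : ℕ) : Type := EuclideanSpace ℝ (Fin n)

variable {n : ℕ} {V : Type*} [NormedAddCommGroup V] [NormedSpace ℝ V]

/-- The space `L²(Ω; V)` with respect to Lebesgue measure. -/
abbrev L2 (Ω : Opens (Euc n)) (V : Type*) [NormedAddCommGroup V] : Type _ :=
  Lp V 2 ((volume : Measure (Euc n)).restrict (Ω : Set (Euc n)))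

/-- The iterated classical partial derivative `∂_{s 0} ∂_{s 1} ⋯ ∂_{s (j-1)} φ` at `x`. -/
def partialDeriv {j : ℕ} (s : Fin j → Fin n) (φ : Euc n → ℝ) (x : Euc n) : ℝ :=
  iteratedFDeriv ℝ j φ x (fun i => EuclideanSpace.single (s i) (1 : ℝ))

/-- `w ∈ L²(Ω; V)` is the weak derivative `∂_{s 0} ⋯ ∂_{s (j-1)} u` of `u ∈ L²(Ω; V)` in `Ω`:
`∫_Ω (∂_s φ) u = (-1)^j ∫_Ω φ w` for all real-valued smooth `φ` with compact support in `Ω`. -/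
def IsWeakDeriv {Ω : Opens (Euc n)} {j : ℕ} (s : Fin j → Fin n) (u w : L2 Ω V) : Prop :=
  ∀ φ : 𝓓(Ω, ℝ),
    ∫ x in (Ω : Set (Euc n)), partialDeriv s φ x • u x =
      (-1 : ℝ) ^ j • ∫ x in (Ω : Set (Euc n)), φ x • w x

section WeakDerivFacts

variable {Ω : Opens (Euc n)} {j : ℕ} {s : Fin j → Fin n}

lemma integrable_smul_L2 {φ : Euc n → ℝ} (hφ : Continuous φ) (hc : HasCompactSupport φ)
    (u : L2 Ω V) :
    Integrable (fun x => φ x • u x) ((volume : Measure (Euc n)).restrict (Ω : Set (Euc n))) := by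
  have h1 : MemLp φ 2 ((volume : Measure (Euc n)).restrict (Ω : Set (Euc n))) :=
    hφ.memLp_of_hasCompactSupport hc
  exact memLp_one_iff_integrable.1 ((Lp.memLp u).smul h1)

lemma integrable_test_smul (φ : 𝓓(Ω, ℝ)) (u : L2 Ω V) :
    Integrable (fun x => φ x • u x) ((volume : Measure (Euc n)).restrict (Ω : Set (Euc n))) :=
  integrable_smul_L2 φ.continuous φ.hasCompactSupport u

lemma integrable_partialDeriv_smul (s : Fin j → Fin n) (φ : 𝓓(Ω, ℝ)) (u : L2 Ω V) :
    Integrable (fun x => partialDeriv s φ x • u x)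
      ((volume : Measure (Euc n)).restrict (Ω : Set (Euc n))) := by
  refine integrable_smul_L2 ?_ ?_ u
  · have h : Continuous (iteratedFDeriv ℝ j φ) :=
      φ.contDiff.continuous_iteratedFDeriv (by exact_mod_cast le_top)
    unfold partialDeriv
    fun_prop
  · refine (φ.hasCompactSupport.iteratedFDeriv (𝕜 := ℝ) j).mono ?_
    intro x hx h0
    exact hx (by simp [partialDeriv, h0])

lemma IsWeakDeriv.add {u w u' w' : L2 Ω V} (h : IsWeakDeriv s u w) (h' : IsWeakDeriv s u' w') :
    IsWeakDeriv s (u + u') (w + w') := by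
  intro φ
  have e1 : ∫ x in (Ω : Set (Euc n)), partialDeriv s φ x • (u + u' : L2 Ω V) x =
      ∫ x in (Ω : Set (Euc n)), (partialDeriv s φ x • u x + partialDeriv s φ x • u' x) := by
    refine integral_congr_ae ?_
    filter_upwards [Lp.coeFn_add u u'] with x hx
    rw [hx, Pi.add_apply, smul_add]
  have e2 : ∫ x in (Ω : Set (Euc n)), φ x • (w + w' : L2 Ω V) x =
      ∫ x in (Ω : Set (Euc n)), (φ x • w x + φ x • w' x) := by
    refine integral_congr_ae ?_
    filter_upwards [Lp.coeFn_add w w'] with x hx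
    rw [hx, Pi.add_apply, smul_add]
  rw [e1, e2, integral_add (integrable_partialDeriv_smul s φ u) (integrable_partialDeriv_smul s φ u'),
    integral_add (integrable_test_smul φ w) (integrable_test_smul φ w'), h φ, h' φ, smul_add]

lemma IsWeakDeriv.const_smul {u w : L2 Ω V} (c : ℝ) (h : IsWeakDeriv s u w) :
    IsWeakDeriv s (c • u) (c • w) := by
  intro φ
  have e1 : ∫ x in (Ω : Set (Euc n)), partialDeriv s φ x • (c • u : L2 Ω V) x =
      ∫ x in (Ω : Set (Euc n)), c • (partialDeriv s φ x • u x) := by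
    refine integral_congr_ae ?_
    filter_upwards [Lp.coeFn_smul c u] with x hx
    rw [hx, Pi.smul_apply, smul_comm]
  have e2 : ∫ x in (Ω : Set (Euc n)), φ x • (c • w : L2 Ω V) x =
      ∫ x in (Ω : Set (Euc n)), c • (φ x • w x) := by
    refine integral_congr_ae ?_
    filter_upwards [Lp.coeFn_smul c w] with x hx
    rw [hx, Pi.smul_apply, smul_comm]
  rw [e1, e2, integral_smul, integral_smul, h φ, smul_comm]

lemma isWeakDeriv_zero : IsWeakDeriv s (0 : L2 Ω V) 0 := by
  have h : ∀ ψ : Euc n → ℝ, ∫ x in (Ω : Set (Euc n)), ψ x • (0 : L2 Ω V) x = 0 := by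
    intro ψ
    refine integral_eq_zero_of_ae ?_
    filter_upwards [Lp.coeFn_zero V 2 ((volume : Measure (Euc n)).restrict (Ω : Set (Euc n)))]
      with x hx
    rw [hx, Pi.zero_apply, smul_zero]
  intro φ
  rw [h, h, smul_zero]

/-- Weak derivatives are unique. -/
lemma IsWeakDeriv.unique [CompleteSpace V] {u w w' : L2 Ω V} (h : IsWeakDeriv s u w)
    (h' : IsWeakDeriv s u w') : w = w' := by
  have key : ∀ᵐ x ∂(volume : Measure (Euc n)), x ∈ (Ω : Set (Euc n)) → w x - w' x = 0 := by
    refine Ω.isOpen.ae_eq_zero_of_integral_contDiff_smul_eq_zero ?_ ?_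
    · intro x hx
      have hw : LocallyIntegrable (fun x => w x - w' x)
          ((volume : Measure (Euc n)).restrict (Ω : Set (Euc n))) :=
        ((Lp.memLp w).sub (Lp.memLp w')).locallyIntegrable (by norm_num)
      obtain ⟨t, ht, hi⟩ := hw x
      refine ⟨t ∩ Ω, Filter.inter_mem (mem_nhdsWithin_of_mem_nhds ht) self_mem_nhdsWithin, ?_⟩
      rw [IntegrableOn, ← Measure.restrict_restrict_of_subset (Set.inter_subset_right (s := t))]
      exact hi.mono_set Set.inter_subset_left
    · intro g hg hgc hgs
      let φ : 𝓓(Ω, ℝ) := ⟨g, hg, hgc, hgs⟩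
      have hφ : ∀ x, φ x = g x := fun _ => rfl
      have e : ∫ x in (Ω : Set (Euc n)), φ x • w x = ∫ x in (Ω : Set (Euc n)), φ x • w' x := by
        have := (h φ).symm.trans (h' φ)
        exact smul_right_injective V (pow_ne_zero j (by norm_num : (-1 : ℝ) ≠ 0)) this
      have e2 : ∫ x in (Ω : Set (Euc n)), g x • (w x - w' x) = 0 := by
        have e3 := integral_sub (integrable_test_smul φ w) (integrable_test_smul φ w')
        simp only [← smul_sub, hφ] at e3
        rw [e3]
        simp only [hφ] at e
        rw [e, sub_self]
      rw [← e2, setIntegral_eq_integral_of_forall_compl_eq_zero]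
      intro x hx
      rw [image_eq_zero_of_notMem_tsupport (fun hx' => hx (hgs hx')), zero_smul]
  refine Lp.ext ?_
  filter_upwards [(ae_restrict_iff' Ω.isOpen.measurableSet).2 key] with x hx
  exact sub_eq_zero.1 hx

lemma isWeakDeriv_self (s : Fin 0 → Fin n) (u : L2 Ω V) : IsWeakDeriv s u u := by
  intro φ
  simp [partialDeriv]

end WeakDerivFacts

/-- The linear space `H^k(Ω; V)`: those `u ∈ L²(Ω; V)` all of whose weak partial derivatives of
order at most `k` exist in `L²(Ω; V)`. -/
def sobolevSubmodule (k : ℕ) (Ω : Opens (Euc n)) (V : Type*) [NormedAddCommGroup V]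
    [NormedSpace ℝ V] : Submodule ℝ (L2 Ω V) where
  carrier := {u | ∀ j ≤ k, ∀ s : Fin j → Fin n, ∃ w : L2 Ω V, IsWeakDeriv s u w}
  add_mem' := by
    intro u u' hu hu' j hj s
    obtain ⟨w, hw⟩ := hu j hj s
    obtain ⟨w', hw'⟩ := hu' j hj s
    exact ⟨w + w', hw.add hw'⟩
  zero_mem' := fun _ _ _ => ⟨0, isWeakDeriv_zero⟩
  smul_mem' := by
    intro c u hu j hj s
    obtain ⟨w, hw⟩ := hu j hj s
    exact ⟨c • w, hw.const_smul c⟩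

/-- The Sobolev space `H^k(Ω; V)`. It is a type of its own, so that it carries the Sobolev norm
defined below and not the `L²` norm. -/
def Sobolev (k : ℕ) (Ω : Opens (Euc n)) (V : Type*) [NormedAddCommGroup V]
    [NormedSpace ℝ V] : Type _ :=
  sobolevSubmodule k Ω V

namespace Sobolev

variable {k : ℕ} {Ω : Opens (Euc n)}

instance : AddCommGroup (Sobolev k Ω V) := inferInstanceAs (AddCommGroup (sobolevSubmodule k Ω V))

instance : Module ℝ (Sobolev k Ω V) := inferInstanceAs (Module ℝ (sobolevSubmodule k Ω V))

/-- The inclusion of `H^k(Ω; V)` in `L²(Ω; V)`. -/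
def toL2 : Sobolev k Ω V →ₗ[ℝ] L2 Ω V := (sobolevSubmodule k Ω V).subtype

/-- Elements of `H^k(Ω; V)` are used as functions on `ℝⁿ` (meaningful almost everywhere
in `Ω`). -/
instance : CoeFun (Sobolev k Ω V) (fun _ => Euc n → V) := ⟨fun u => (toL2 u : Euc n → V)⟩

lemma toL2_injective : Function.Injective (toL2 : Sobolev k Ω V → L2 Ω V) :=
  Subtype.val_injective

/-- Index set of the iterated partial derivatives of order at most `k` in `n` variables. -/
abbrev Index (k n : ℕ) : Type := Σ j : Fin (k + 1), (Fin (j : ℕ) → Fin n)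

/-- The weak derivative `∂_{s 0} ⋯ ∂_{s (j-1)} u ∈ L²(Ω; V)` of `u ∈ H^k(Ω; V)`, `j ≤ k`. -/
def weakDeriv (a : Index k n) (u : Sobolev k Ω V) : L2 Ω V :=
  Classical.choose (u.2 a.1 (Nat.lt_succ_iff.1 a.1.2) a.2)

lemma isWeakDeriv_weakDeriv (a : Index k n) (u : Sobolev k Ω V) :
    IsWeakDeriv a.2 (toL2 u) (weakDeriv a u) :=
  Classical.choose_spec (u.2 a.1 (Nat.lt_succ_iff.1 a.1.2) a.2)

variable [CompleteSpace V]

/-- The family of all weak derivatives of order at most `k`, in the Hilbert sum of copies of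
`L²(Ω; V)`. -/
def jet : Sobolev k Ω V →ₗ[ℝ] PiLp 2 (fun _ : Index k n => L2 Ω V) where
  toFun u := WithLp.toLp 2 (fun a => weakDeriv a u)
  map_add' u v := by
    ext1 a
    refine (isWeakDeriv_weakDeriv a (u + v)).unique ?_
    rw [map_add]
    exact (isWeakDeriv_weakDeriv a u).add (isWeakDeriv_weakDeriv a v)
  map_smul' c u := by
    ext1 a
    refine (isWeakDeriv_weakDeriv a (c • u)).unique ?_
    rw [map_smul]
    exact (isWeakDeriv_weakDeriv a u).const_smul c

lemma jet_injective : Function.Injective (jet : Sobolev k Ω V → _) := by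
  intro u v h
  let a : Index k n := ⟨0, Fin.elim0⟩
  have hu : weakDeriv a u = toL2 u := (isWeakDeriv_weakDeriv a u).unique (isWeakDeriv_self _ _)
  have hv : weakDeriv a v = toL2 v := (isWeakDeriv_weakDeriv a v).unique (isWeakDeriv_self _ _)
  refine toL2_injective ?_
  rw [← hu, ← hv]
  exact congrArg (fun w : PiLp 2 (fun _ : Index k n => L2 Ω V) => w a) h

/-- The Sobolev norm, pulled back from the Hilbert sum: see `norm_sq_eq`. -/
instance : NormedAddCommGroup (Sobolev k Ω V) :=
  NormedAddCommGroup.induced _ _ jet jet_injective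

instance : NormedSpace ℝ (Sobolev k Ω V) := NormedSpace.induced ℝ _ _ jet

/-- The squared Sobolev norm is the sum of the squared `L²` norms of all iterated weak partial
derivatives of order at most `k`. -/
lemma norm_sq_eq (u : Sobolev k Ω V) : ‖u‖ ^ 2 = ∑ a : Index k n, ‖weakDeriv a u‖ ^ 2 :=
  PiLp.norm_sq_eq_of_L2 (fun _ : Index k n => L2 Ω V) (jet u)

end Sobolev

/-- `Ω` is an extension domain (for Sobolev functions of order `k`): there is a bounded linear
operator `H^k(Ω) → H^k(ℝⁿ)`, on real-valued functions, with `E u = u` almost everywhere in `Ω`. -/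
def IsExtensionDomain (k : ℕ) (Ω : Opens (Euc n)) : Prop :=
  ∃ E : Sobolev k Ω ℝ →L[ℝ] Sobolev k (⊤ : Opens (Euc n)) ℝ,
    ∀ u : Sobolev k Ω ℝ,
      (E u : Euc n → ℝ) =ᵐ[(volume : Measure (Euc n)).restrict (Ω : Set (Euc n))] u

/-- `f ∈ C^r_b(ℝⁿ; V)`: `f` is `r` times continuously differentiable, and `f` and all its
derivatives of order at most `r` are bounded. -/
def MemCb (r : ℕ) (f : Euc n → V) : Prop :=
  ContDiff ℝ r f ∧ ∀ j ≤ r, ∃ C : ℝ, ∀ x, ‖iteratedFDeriv ℝ j f x‖ ≤ C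

end SobolevComp

end

set_option linter.unusedSectionVars false

/-! Everything is done for scalar functions on the whole space and then transferred. With `k = κ +
1`, the hypothesis on `k` gives `n < 2κ`. If `E` extends componentwise and `R` restricts to `Ω`,
then `f ∘ u = f(0) + R((f - f(0)) ∘ E u)`. The constant `f(0)` lies in `H^k(Ω)` when `Ω` has finite
measure and vanishes otherwise. Apart from that constant, the map is a superposition operator on the
whole space composed with bounded linear maps, and its outer function vanishes at the origin.

The analytic core is the multiplication `H^s × H^t → H^r` for `r ≤ s, t` and `s + t - r > n/2`
(`exists_mul`). For `r = 0` it is a weighted Young inequality on the Fourier side. It passes from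
Schwartz functions to all Sobolev functions by density and Fatou. The Leibniz rule then raises `r`.

Continuity (`exists_comp_continuous`) is an induction on the target order `j`. A Lipschitz `g` with
`g(0) = 0` acts continuously on `L²`, and the chain rule gives `∂_i(g ∘ U) = ∑_l (∂_l g ∘ U) ∂_i
U_l`. Here `∂_l g ∘ U` is controlled in `H^j` by induction once the constant `∂_l g(0)` is
subtracted, and `∂_i U_l ∈ H^κ` multiplies `H^j` into itself because `n < 2κ`.

Smoothness (`exists_comp_contDiff`) is an induction on `m`. The candidate derivative `A(U)H = ∑_l
(∂_l g ∘ U) H_l` is `C^m` by the induction hypothesis. Taylor's formula and the algebra property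
show that `A` is the derivative in the weaker `L²` norm. Since `A` is continuous into operators with
values in `H^k`, the fundamental theorem of calculus upgrades this to differentiability in `H^k`
(`hasFDerivAt_of_clm_comp`). -/

noncomputable section

namespace SobolevComp

/-! ### First order weak partial derivatives -/

section Partial

variable {n : ℕ} {V : Type*} [NormedAddCommGroup V] [NormedSpace ℝ V]
  {W : Type*} [NormedAddCommGroup W] [NormedSpace ℝ W]
  {Ω : Opens (Euc n)}

/-- The standard basis vectors. -/
abbrev basisVec (i : Fin n) : Euc n := EuclideanSpace.single i (1 : ℝ)

/-- First order weak partial derivatives. -/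
def IsWeakPartial (i : Fin n) (u w : L2 Ω V) : Prop :=
  ∀ φ : 𝓓(Ω, ℝ),
    ∫ x in (Ω : Set (Euc n)), fderiv ℝ φ x (basisVec i) • u x =
      -∫ x in (Ω : Set (Euc n)), φ x • w x

lemma isWeakDeriv_one_iff {s : Fin 1 → Fin n} {u w : L2 Ω V} :
    IsWeakDeriv s u w ↔ IsWeakPartial (s 0) u w := by
  simp [IsWeakDeriv, IsWeakPartial, partialDeriv, iteratedFDeriv_one_apply]

lemma partialDeriv_succ {j : ℕ} (s : Fin (j + 1) → Fin n) {φ : Euc n → ℝ}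
    (hφ : ContDiff ℝ (⊤ : ℕ∞) φ) (x : Euc n) :
    partialDeriv s φ x =
      fderiv ℝ (partialDeriv (Fin.tail s) φ) x (basisVec (s 0)) := by
  have h : DifferentiableAt ℝ (iteratedFDeriv ℝ j φ) x :=
    (hφ.differentiable_iteratedFDeriv (by exact_mod_cast WithTop.coe_lt_top j)) x
  unfold partialDeriv
  rw [iteratedFDeriv_succ_apply_left, fderiv_continuousMultilinear_apply_const_apply h]
  rfl

lemma contDiff_partialDeriv {j : ℕ} (s : Fin j → Fin n) {φ : Euc n → ℝ}
    (hφ : ContDiff ℝ (⊤ : ℕ∞) φ) : ContDiff ℝ (⊤ : ℕ∞) (partialDeriv s φ) := by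
  induction j with
  | zero =>
    have e : partialDeriv s φ = φ := by
      funext x
      simp [partialDeriv]
    rwa [e]
  | succ j ih =>
    rw [funext (partialDeriv_succ s hφ)]
    exact ((ih (Fin.tail s)).fderiv_right (m := (⊤ : ℕ∞)) (by simp)).clm_apply contDiff_const

lemma support_partialDeriv_subset {j : ℕ} (s : Fin j → Fin n) (φ : Euc n → ℝ) :
    tsupport (partialDeriv s φ) ⊆ tsupport φ := by
  refine closure_minimal ?_ (isClosed_tsupport φ)
  intro x hx
  refine (support_iteratedFDeriv_subset (𝕜 := ℝ) j (f := φ)) ?_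
  intro h0
  exact hx (by simp [partialDeriv, h0])

/-- A partial derivative of a test function, as a test function. -/
def partialTest {j : ℕ} (s : Fin j → Fin n) (φ : 𝓓(Ω, ℝ)) : 𝓓(Ω, ℝ) where
  toFun := partialDeriv s φ
  contDiff' := contDiff_partialDeriv s φ.contDiff
  hasCompactSupport' :=
    φ.hasCompactSupport.of_isClosed_subset (isClosed_tsupport _) (support_partialDeriv_subset s φ)
  tsupport_subset' := (support_partialDeriv_subset s φ).trans φ.tsupport_subset

lemma partialTest_apply {j : ℕ} (s : Fin j → Fin n) (φ : 𝓓(Ω, ℝ)) (x : Euc n) :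
    partialTest s φ x = partialDeriv s φ x := rfl

lemma IsWeakPartial.integral_partialDeriv {j : ℕ} {s : Fin (j + 1) → Fin n} {u w : L2 Ω V}
    (h : IsWeakPartial (s 0) u w) (φ : 𝓓(Ω, ℝ)) :
    ∫ x in (Ω : Set (Euc n)), partialDeriv s φ x • u x =
      -∫ x in (Ω : Set (Euc n)), partialDeriv (Fin.tail s) φ x • w x := by
  have := h (partialTest (Fin.tail s) φ)
  simp only [partialTest_apply] at this
  rw [← this]
  congr 1
  funext x
  rw [partialDeriv_succ s φ.contDiff]
  rfl

/-- A partial derivative of a test function is again a test function, so the outermost derivative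
can be moved onto `u` first. This makes induction on the Sobolev order possible. -/
lemma IsWeakPartial.isWeakDeriv_iff {j : ℕ} {s : Fin (j + 1) → Fin n} {u w v : L2 Ω V}
    (h : IsWeakPartial (s 0) u w) : IsWeakDeriv s u v ↔ IsWeakDeriv (Fin.tail s) w v := by
  unfold IsWeakDeriv
  refine forall_congr' fun φ => ?_
  rw [h.integral_partialDeriv φ, pow_succ, mul_neg_one, neg_smul, neg_inj]

lemma IsWeakDeriv.comp_clm [CompleteSpace V] [CompleteSpace W] (T : V →L[ℝ] W) {j : ℕ}
    {s : Fin j → Fin n} {u w : L2 Ω V}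
    (h : IsWeakDeriv s u w) : IsWeakDeriv s (T.compLp u) (T.compLp w) := by
  intro φ
  have e : ∀ (g : Euc n → ℝ) (v : L2 Ω V),
      Integrable (fun x => g x • v x) (volume.restrict (Ω : Set (Euc n))) →
      ∫ x in (Ω : Set (Euc n)), g x • T.compLp v x =
        T (∫ x in (Ω : Set (Euc n)), g x • v x) := by
    intro g v hi
    rw [← T.integral_comp_comm hi]
    refine integral_congr_ae ?_
    filter_upwards [T.coeFn_compLp v] with x hx
    rw [hx, map_smul]
  rw [e _ _ (integrable_partialDeriv_smul s φ u), e _ _ (integrable_test_smul φ w), h φ, map_smul]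

/-- The pairing of an `L²` function with a fixed scalar `L²` function. -/
lemma continuous_integral_smul {μ : Measure (Euc n)} {φ : Euc n → ℝ} (hφ : MemLp φ 2 μ) :
    Continuous fun u : Lp V 2 μ => ∫ x, φ x • u x ∂μ := by
  have hi : ∀ u : Lp V 2 μ, Integrable (fun x => φ x • u x) μ := fun u =>
    memLp_one_iff_integrable.1 ((Lp.memLp u).smul hφ)
  have hb : ∀ u : Lp V 2 μ, ‖∫ x, φ x • u x ∂μ‖ ≤ (eLpNorm φ 2 μ).toReal * ‖u‖ := by
    intro u
    have h1 : eLpNorm (fun x => φ x • u x) 1 μ ≤ eLpNorm φ 2 μ * eLpNorm u 2 μ :=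
      eLpNorm_smul_le_mul_eLpNorm (Lp.aestronglyMeasurable u) hφ.1
    rw [Lp.norm_def, ← ENNReal.toReal_mul]
    refine (norm_integral_le_integral_norm _).trans ?_
    rw [integral_norm_eq_lintegral_enorm (hi u).1, ← eLpNorm_one_eq_lintegral_enorm]
    exact ENNReal.toReal_mono (ENNReal.mul_ne_top hφ.2.ne (Lp.memLp u).2.ne) h1
  let F : Lp V 2 μ →ₗ[ℝ] V :=
    { toFun := fun u => ∫ x, φ x • u x ∂μ
      map_add' := by
        intro u v
        rw [← integral_add (hi u) (hi v)]
        refine integral_congr_ae ?_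
        filter_upwards [Lp.coeFn_add u v] with x hx
        rw [hx, Pi.add_apply, smul_add]
      map_smul' := by
        intro c u
        rw [RingHom.id_apply, ← integral_smul]
        refine integral_congr_ae ?_
        filter_upwards [Lp.coeFn_smul c u] with x hx
        rw [hx, Pi.smul_apply, smul_comm] }
  exact (F.mkContinuous _ hb).continuous

lemma memLp_test (φ : 𝓓(Ω, ℝ)) : MemLp φ 2 (volume.restrict (Ω : Set (Euc n))) :=
  φ.continuous.memLp_of_hasCompactSupport φ.hasCompactSupport

lemma memLp_partialDeriv {j : ℕ} (s : Fin j → Fin n) (φ : 𝓓(Ω, ℝ)) :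
    MemLp (partialDeriv s φ) 2 (volume.restrict (Ω : Set (Euc n))) :=
  memLp_test (partialTest s φ)

/-- For each fixed test function both sides of the defining identity are `L²`-continuous. The
closedness yields completeness of the Sobolev spaces. -/
lemma isClosed_isWeakDeriv {j : ℕ} (s : Fin j → Fin n) :
    IsClosed {p : L2 Ω V × L2 Ω V | IsWeakDeriv s p.1 p.2} := by
  simp only [IsWeakDeriv, Set.ofPred_forall]
  refine isClosed_iInter fun φ => isClosed_eq ?_ ?_
  · exact (continuous_integral_smul (memLp_partialDeriv s φ)).comp continuous_fst
  · exact ((continuous_integral_smul (memLp_test φ)).comp continuous_snd).const_smul _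

end Partial

/-! ### Operators between Sobolev spaces, recursion on the order, completeness -/

namespace Sobolev

variable {n k : ℕ} {Ω : Opens (Euc n)} {V : Type*} [NormedAddCommGroup V] [NormedSpace ℝ V]
  [CompleteSpace V] {W : Type*} [NormedAddCommGroup W] [NormedSpace ℝ W] [CompleteSpace W]

/-- A member of the Sobolev submodule, as an element of the Sobolev space. -/
def ofMem (u : L2 Ω V) (hu : u ∈ sobolevSubmodule k Ω V) : Sobolev k Ω V := ⟨u, hu⟩

@[simp] lemma toL2_ofMem (u : L2 Ω V) (hu : u ∈ sobolevSubmodule k Ω V) :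
    toL2 (ofMem u hu) = u := rfl

lemma toL2_mem (u : Sobolev k Ω V) : toL2 u ∈ sobolevSubmodule k Ω V := u.2

lemma ext_ae {u v : Sobolev k Ω V}
    (h : (u : Euc n → V) =ᵐ[volume.restrict (Ω : Set (Euc n))] v) : u = v :=
  toL2_injective (Lp.ext h)

lemma weakDeriv_eq {a : Index k n} {u : Sobolev k Ω V} {w : L2 Ω V}
    (h : IsWeakDeriv a.2 (toL2 u) w) : weakDeriv a u = w :=
  (isWeakDeriv_weakDeriv a u).unique h

lemma norm_weakDeriv_le (a : Index k n) (u : Sobolev k Ω V) : ‖weakDeriv a u‖ ≤ ‖u‖ :=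
  PiLp.norm_apply_le (jet u) a

lemma norm_le_sum (u : Sobolev k Ω V) : ‖u‖ ≤ ∑ a : Index k n, ‖weakDeriv a u‖ := by
  rw [← abs_of_nonneg (norm_nonneg u), ← abs_of_nonneg (a := ∑ a : Index k n, ‖weakDeriv a u‖)
    (Finset.sum_nonneg fun _ _ => norm_nonneg _), ← sq_le_sq, norm_sq_eq]
  exact Finset.sum_sq_le_sq_sum_of_nonneg fun _ _ => norm_nonneg _

/-- A linear map into a Sobolev space is bounded if all weak derivatives are. -/
def mkCLM {X : Type*} [SeminormedAddCommGroup X] [NormedSpace ℝ X] (T : X →ₗ[ℝ] Sobolev k Ω V)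
    (C : ℝ) (h : ∀ a x, ‖weakDeriv a (T x)‖ ≤ C * ‖x‖) : X →L[ℝ] Sobolev k Ω V :=
  T.mkContinuous (Fintype.card (Index k n) * C) fun x => by
    refine (norm_le_sum _).trans ((Finset.sum_le_sum fun a _ => h a x).trans ?_)
    simp [mul_assoc]

lemma weakDeriv_zero_index (s : Fin 0 → Fin n) (u : Sobolev k Ω V) :
    weakDeriv ⟨0, s⟩ u = toL2 u :=
  weakDeriv_eq (isWeakDeriv_self _ _)

lemma norm_toL2_le (u : Sobolev k Ω V) : ‖toL2 u‖ ≤ ‖u‖ := by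
  rw [← weakDeriv_zero_index Fin.elim0 u]
  exact norm_weakDeriv_le _ u

/-- The inclusion of the Sobolev space in `L²`, as a bounded operator. -/
def toL2CLM : Sobolev k Ω V →L[ℝ] L2 Ω V :=
  toL2.mkContinuous 1 fun u => by simpa using norm_toL2_le u

@[simp] lemma toL2CLM_apply (u : Sobolev k Ω V) : toL2CLM u = toL2 u := rfl

lemma mem_sobolevSubmodule_mono {j : ℕ} (h : j ≤ k) {u : L2 Ω V}
    (hu : u ∈ sobolevSubmodule k Ω V) : u ∈ sobolevSubmodule j Ω V :=
  fun i hi s => hu i (hi.trans h) s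

lemma norm_weakDeriv_le_of_toL2_eq {j : ℕ} (h : j ≤ k) {v : Sobolev j Ω V} {u : Sobolev k Ω V}
    (e : toL2 v = toL2 u) (a : Index j n) : ‖weakDeriv a v‖ ≤ ‖u‖ := by
  have hd := isWeakDeriv_weakDeriv (⟨⟨a.1, by omega⟩, a.2⟩ : Index k n) u
  rw [← e] at hd
  rw [weakDeriv_eq hd]
  exact norm_weakDeriv_le _ u

/-- The inclusion `H^k ⊆ H^j` for `j ≤ k`, as a linear map. -/
def inclₗ {j : ℕ} (h : j ≤ k) : Sobolev k Ω V →ₗ[ℝ] Sobolev j Ω V where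
  toFun u := ofMem (toL2 u) (mem_sobolevSubmodule_mono h (toL2_mem u))
  map_add' _ _ := rfl
  map_smul' _ _ := rfl

/-- The inclusion `H^k ⊆ H^j` for `j ≤ k`. -/
def incl {j : ℕ} (h : j ≤ k) : Sobolev k Ω V →L[ℝ] Sobolev j Ω V :=
  mkCLM (inclₗ h) 1 fun a u => by
    rw [one_mul]
    exact norm_weakDeriv_le_of_toL2_eq h rfl a

@[simp] lemma toL2_incl {j : ℕ} (h : j ≤ k) (u : Sobolev k Ω V) : toL2 (incl h u) = toL2 u := rfl

lemma compLp_mem (T : V →L[ℝ] W) (u : Sobolev k Ω V) :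
    T.compLp (toL2 u) ∈ sobolevSubmodule k Ω W := by
  intro j hj s
  obtain ⟨w, hw⟩ := u.2 j hj s
  exact ⟨_, hw.comp_clm T⟩

/-- Postcomposition with a bounded operator between the target spaces. -/
def mapCLM (T : V →L[ℝ] W) : Sobolev k Ω V →L[ℝ] Sobolev k Ω W :=
  mkCLM
    { toFun := fun u => ofMem (T.compLp (toL2 u)) (compLp_mem T u)
      map_add' := fun u v => toL2_injective ((T.compLpL 2 _).map_add (toL2 u) (toL2 v))
      map_smul' := fun c u => toL2_injective ((T.compLpL 2 _).map_smul c (toL2 u)) } ‖T‖ fun a u => by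
    have hw : weakDeriv a (ofMem (T.compLp (toL2 u)) (compLp_mem T u)) =
        T.compLp (weakDeriv a u) := weakDeriv_eq ((isWeakDeriv_weakDeriv _ u).comp_clm T)
    simp only [LinearMap.coe_mk, AddHom.coe_mk, hw]
    exact (T.norm_compLp_le _).trans (by gcongr; exact norm_weakDeriv_le _ u)

lemma coeFn_mapCLM (T : V →L[ℝ] W) (u : Sobolev k Ω V) :
    (mapCLM T u : Euc n → W) =ᵐ[volume.restrict (Ω : Set (Euc n))] fun x => T (u x) :=
  T.coeFn_compLp (toL2 u)

/-- The value of `∂_i u` for `u ∈ H^{k+1}`, as an `L²` function. -/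
def partialL2 (i : Fin n) (u : Sobolev (k + 1) Ω V) : L2 Ω V :=
  weakDeriv ⟨⟨1, by omega⟩, fun _ => i⟩ u

lemma isWeakPartial_partialL2 (i : Fin n) (u : Sobolev (k + 1) Ω V) :
    IsWeakPartial i (toL2 u) (partialL2 i u) :=
  isWeakDeriv_one_iff.1 (isWeakDeriv_weakDeriv ⟨⟨1, by omega⟩, fun _ => i⟩ u)

lemma isWeakDeriv_partialL2 (i : Fin n) (u : Sobolev (k + 1) Ω V) {j : ℕ} (hj : j < k + 1)
    (s : Fin j → Fin n) :
    IsWeakDeriv s (partialL2 i u) (weakDeriv ⟨⟨j + 1, by omega⟩, Fin.cons i s⟩ u) := by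
  have h := isWeakDeriv_weakDeriv ⟨⟨j + 1, by omega⟩, Fin.cons i s⟩ u
  have h1 : IsWeakPartial ((Fin.cons i s : Fin (j + 1) → Fin n) 0) (toL2 u) (partialL2 i u) :=
    isWeakPartial_partialL2 i u
  simpa using h1.isWeakDeriv_iff.1 h

lemma partialL2_mem (i : Fin n) (u : Sobolev (k + 1) Ω V) :
    partialL2 i u ∈ sobolevSubmodule k Ω V := fun _ hj s =>
  ⟨_, isWeakDeriv_partialL2 i u (Nat.lt_succ_of_le hj) s⟩

/-- The partial derivative `∂_i : H^{k+1} → H^k`. -/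
def partialCLM (i : Fin n) : Sobolev (k + 1) Ω V →L[ℝ] Sobolev k Ω V :=
  mkCLM
    { toFun := fun u => ofMem (partialL2 i u) (partialL2_mem i u)
      map_add' := fun u v => toL2_injective <|
        congrArg (fun w : PiLp 2 (fun _ : Index (k + 1) n => L2 Ω V) =>
          w ⟨⟨1, by omega⟩, fun _ => i⟩) (jet.map_add u v)
      map_smul' := fun c u => toL2_injective <|
        congrArg (fun w : PiLp 2 (fun _ : Index (k + 1) n => L2 Ω V) =>
          w ⟨⟨1, by omega⟩, fun _ => i⟩) (jet.map_smul c u) } 1 fun a u => by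
    have hw : weakDeriv a (ofMem (partialL2 i u) (partialL2_mem i u)) =
        weakDeriv ⟨⟨a.1 + 1, by omega⟩, Fin.cons i a.2⟩ u :=
      weakDeriv_eq (isWeakDeriv_partialL2 i u a.1.2 a.2)
    simpa [hw] using norm_weakDeriv_le _ u

lemma isWeakPartial_partialCLM (i : Fin n) (u : Sobolev (k + 1) Ω V) :
    IsWeakPartial i (toL2 u) (toL2 (partialCLM i u)) := isWeakPartial_partialL2 i u

lemma partialCLM_eq {i : Fin n} {u : Sobolev (k + 1) Ω V} {w : Sobolev k Ω V}
    (h : IsWeakPartial i (toL2 u) (toL2 w)) : partialCLM i u = w :=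
  toL2_injective <| (isWeakDeriv_one_iff (s := fun _ => i)).2 (isWeakPartial_partialCLM i u)
    |>.unique (isWeakDeriv_one_iff.2 h)

/-- An `L²` function whose weak partial derivatives are in `H^k` is in `H^{k+1}`. -/
lemma mem_succ {u : L2 Ω V} (w : Fin n → Sobolev k Ω V)
    (h : ∀ i, IsWeakPartial i u (toL2 (w i))) : u ∈ sobolevSubmodule (k + 1) Ω V := by
  intro j hj s
  cases j with
  | zero => exact ⟨u, isWeakDeriv_self s u⟩
  | succ j =>
    obtain ⟨v, hv⟩ := (w (s 0)).2 j (by omega) (Fin.tail s)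
    exact ⟨v, (h (s 0)).isWeakDeriv_iff.2 hv⟩

/-- The element of `H^{k+1}` given by an `L²` function and its partial derivatives in `H^k`. -/
lemma exists_succ {u : L2 Ω V} (w : Fin n → Sobolev k Ω V)
    (h : ∀ i, IsWeakPartial i u (toL2 (w i))) :
    ∃ v : Sobolev (k + 1) Ω V, toL2 v = u ∧ ∀ i, partialCLM i v = w i :=
  ⟨ofMem u (mem_succ w h), rfl, fun i => partialCLM_eq (h i)⟩

lemma mem_zero (u : L2 Ω V) : u ∈ sobolevSubmodule 0 Ω V := by
  intro j hj s
  obtain rfl : j = 0 := by omega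
  exact ⟨u, isWeakDeriv_self s u⟩

lemma norm_zero_order_le (u : Sobolev 0 Ω V) :
    ‖u‖ ≤ Fintype.card (Index 0 n) * ‖toL2 u‖ := by
  refine (norm_le_sum u).trans ?_
  refine (Finset.sum_le_card_nsmul _ _ ‖toL2 u‖ ?_).trans (by simp)
  rintro ⟨⟨j, hj⟩, s⟩ -
  obtain rfl : j = 0 := by omega
  exact (congrArg norm (weakDeriv_zero_index s u)).le

/-- Every derivative of positive order is a derivative of order at most `k` of some `∂_i u`. Bounds
and continuity in `H^{k+1}` thus reduce to `L²` and to `H^k` for the partial derivatives. -/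
lemma norm_succ_le (u : Sobolev (k + 1) Ω V) :
    ‖u‖ ≤ Fintype.card (Index (k + 1) n) * (‖toL2 u‖ + ∑ i, ‖partialCLM i u‖) := by
  refine (norm_le_sum u).trans ?_
  refine (Finset.sum_le_card_nsmul _ _ (‖toL2 u‖ + ∑ i, ‖partialCLM i u‖) ?_).trans
    (by rw [nsmul_eq_mul, Finset.card_univ])
  have h0 : 0 ≤ ∑ i, ‖partialCLM i u‖ := Finset.sum_nonneg fun _ _ => norm_nonneg _
  rintro ⟨⟨j, hj⟩, s⟩ -
  cases j with
  | zero => exact (congrArg norm (weakDeriv_zero_index s u)).le.trans (by simpa using h0)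
  | succ j =>
    have e : weakDeriv ⟨⟨j + 1, hj⟩, s⟩ u =
        weakDeriv ⟨⟨j, by omega⟩, Fin.tail s⟩ (partialCLM (s 0) u) := by
      refine weakDeriv_eq ?_
      exact (isWeakPartial_partialCLM (s 0) u).isWeakDeriv_iff.2
        (isWeakDeriv_weakDeriv ⟨⟨j, by omega⟩, Fin.tail s⟩ (partialCLM (s 0) u))
    rw [e]
    have h1 := norm_weakDeriv_le ⟨⟨j, by omega⟩, Fin.tail s⟩ (partialCLM (s 0) u)
    have h2 : ‖partialCLM (s 0) u‖ ≤ ∑ i, ‖partialCLM i u‖ :=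
      Finset.single_le_sum (f := fun i => ‖partialCLM i u‖) (fun _ _ => norm_nonneg _)
        (Finset.mem_univ _)
    linarith [norm_nonneg (toL2 u)]

lemma continuous_zero_of {X : Type*} [TopologicalSpace X] {F : X → Sobolev 0 Ω V}
    (h : Continuous fun x => toL2 (F x)) : Continuous F := by
  rw [continuous_iff_continuousAt]
  intro x
  rw [ContinuousAt, tendsto_iff_norm_sub_tendsto_zero]
  have h1 := tendsto_iff_norm_sub_tendsto_zero.1 (h.tendsto x)
  refine squeeze_zero (fun _ => norm_nonneg _) (fun y => norm_zero_order_le _) ?_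
  simpa using h1.const_mul (Fintype.card (Index 0 n) : ℝ)

lemma continuous_succ_of {X : Type*} [TopologicalSpace X] {F : X → Sobolev (k + 1) Ω V}
    (h : Continuous fun x => toL2 (F x)) (h' : ∀ i, Continuous fun x => partialCLM i (F x)) :
    Continuous F := by
  rw [continuous_iff_continuousAt]
  intro x
  rw [ContinuousAt, tendsto_iff_norm_sub_tendsto_zero]
  have h1 := tendsto_iff_norm_sub_tendsto_zero.1 (h.tendsto x)
  have h2 := fun i => tendsto_iff_norm_sub_tendsto_zero.1 ((h' i).tendsto x)
  refine squeeze_zero (fun _ => norm_nonneg _) (fun y => norm_succ_le _) ?_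
  simpa using (h1.add (tendsto_finsetSum Finset.univ fun i _ => h2 i)).const_mul
    (Fintype.card (Index (k + 1) n) : ℝ)

/-- The map `jet` is an isometry, and its range is cut out by the closed conditions that each
component is a weak derivative of the component of order zero. Completeness is needed later to
integrate in `H^k`. -/
instance : CompleteSpace (Sobolev k Ω V) := by
  have hj : Isometry (jet : Sobolev k Ω V → PiLp 2 (fun _ : Index k n => L2 Ω V)) :=
    AddMonoidHomClass.isometry_of_norm _ fun _ => rfl
  refine (completeSpace_iff_isComplete_range hj.isUniformInducing).2 (IsClosed.isComplete ?_)
  let a₀ : Index k n := ⟨0, Fin.elim0⟩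
  have e : Set.range (jet : Sobolev k Ω V → PiLp 2 (fun _ : Index k n => L2 Ω V)) =
      ⋂ a : Index k n, {w | IsWeakDeriv a.2 (w a₀) (w a)} := by
    ext w
    simp only [Set.mem_range, Set.mem_iInter, Set.mem_ofPred_eq]
    constructor
    · rintro ⟨u, rfl⟩ a
      have h0 : jet u a₀ = toL2 u := weakDeriv_zero_index _ u
      rw [h0]
      exact isWeakDeriv_weakDeriv a u
    · intro h
      have hm : w a₀ ∈ sobolevSubmodule k Ω V := fun j hj s => ⟨_, h ⟨⟨j, by omega⟩, s⟩⟩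
      refine ⟨ofMem (w a₀) hm, ?_⟩
      ext1 a
      exact weakDeriv_eq (h a)
  rw [e]
  refine isClosed_iInter fun a => ?_
  have hc : Continuous fun w : PiLp 2 (fun _ : Index k n => L2 Ω V) => (w a₀, w a) := by fun_prop
  exact (isClosed_isWeakDeriv a.2).preimage hc

end Sobolev

end SobolevComp

end

noncomputable section

namespace SobolevComp

open scoped SchwartzMap FourierTransform LineDeriv
open Filter Topology

/-! ### Weak derivatives tested against Schwartz functions -/

section SchwartzTests

variable {n : ℕ} {V : Type*} [NormedAddCommGroup V] [NormedSpace ℝ V]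

lemma restrict_top_eq :
    (volume : Measure (Euc n)).restrict ((⊤ : Opens (Euc n)) : Set (Euc n)) = volume := by
  simp

lemma ae_top_iff {p : Euc n → Prop} :
    (∀ᵐ x ∂(volume : Measure (Euc n)).restrict ((⊤ : Opens (Euc n)) : Set (Euc n)), p x) ↔
      ∀ᵐ x ∂(volume : Measure (Euc n)), p x := by
  rw [restrict_top_eq]

lemma eLpNorm_top (g : Euc n → V) (p : ℝ≥0∞) :
    eLpNorm g p (volume.restrict ((⊤ : Opens (Euc n)) : Set (Euc n))) = eLpNorm g p volume := by
  rw [restrict_top_eq]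

lemma memLp_top_iff {g : Euc n → V} {p : ℝ≥0∞} :
    MemLp g p (volume.restrict ((⊤ : Opens (Euc n)) : Set (Euc n))) ↔ MemLp g p volume := by
  rw [restrict_top_eq]

lemma memLp_two_top (u : L2 (⊤ : Opens (Euc n)) V) : MemLp u 2 (volume : Measure (Euc n)) :=
  memLp_top_iff.1 (Lp.memLp u)

lemma integral_top (g : Euc n → V) :
    ∫ x in ((⊤ : Opens (Euc n)) : Set (Euc n)), g x = ∫ x, g x := by
  rw [restrict_top_eq]

lemma isWeakPartial_top_iff {i : Fin n} {u w : L2 (⊤ : Opens (Euc n)) V} :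
    IsWeakPartial i u w ↔ ∀ φ : 𝓓((⊤ : Opens (Euc n)), ℝ),
      ∫ x, fderiv ℝ φ x (basisVec i) • u x = -∫ x, φ x • w x := by
  unfold IsWeakPartial
  simp only [integral_top]

/-- Smooth compactly supported functions, as test functions on the whole space. -/
def testOfContDiff (φ : Euc n → ℝ) (h : ContDiff ℝ (⊤ : ℕ∞) φ) (hc : HasCompactSupport φ) :
    𝓓((⊤ : Opens (Euc n)), ℝ) := ⟨φ, h, hc, fun _ _ => trivial⟩

/-- Weak partial derivatives may be tested against real Schwartz functions. -/
lemma IsWeakPartial.integral_schwartz {i : Fin n} {u w : L2 (⊤ : Opens (Euc n)) V}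
    (h : IsWeakPartial i u w) (ψ : 𝓢(Euc n, ℝ)) :
    ∫ x, fderiv ℝ ψ x (basisVec i) • u x = -∫ x, ψ x • w x := by
  let χ : ContDiffBump (0 : Euc n) := ⟨1, 2, one_pos, one_lt_two⟩
  -- The cutoffs `η N x = χ (c N • x)` are eventually `1` at each point and have gradient at most `c
  -- N * C`. The commutator term `∂_i(η N) ψ` therefore disappears in the limit, and dominated
  -- convergence applies to the tests `η N * ψ`.
  let c : ℕ → ℝ := fun N => ((N : ℝ) + 1)⁻¹
  have hc0 : ∀ N, 0 < c N := fun N => by positivity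
  have hc1 : ∀ N, c N ≤ 1 := fun N => inv_le_one_of_one_le₀ (by simp)
  have hcl : Tendsto c atTop (𝓝 0) := by
    simpa [c] using tendsto_one_div_add_atTop_nhds_zero_nat (𝕜 := ℝ)
  have hχs : ContDiff ℝ (⊤ : ℕ∞) χ := χ.contDiff
  have hψs : ContDiff ℝ (⊤ : ℕ∞) ψ := ψ.smooth ⊤
  let η : ℕ → Euc n → ℝ := fun N x => χ (c N • x)
  have hηs : ∀ N, ContDiff ℝ (⊤ : ℕ∞) (η N) := fun N => hχs.comp (contDiff_id.const_smul (c N))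
  have hηc : ∀ N, HasCompactSupport (η N) := fun N =>
    χ.hasCompactSupport.comp_smul (hc0 N).ne'
  have hη1 : ∀ N x, |η N x| ≤ 1 := fun N x => by
    rw [abs_of_nonneg χ.nonneg]
    exact χ.le_one
  have hηlim : ∀ x, ∀ᶠ N in atTop, η N x = 1 := by
    intro x
    have h1 : Tendsto (fun N => c N • x) atTop (𝓝 0) := by simpa using hcl.smul_const x
    filter_upwards [h1 (Metric.closedBall_mem_nhds (0 : Euc n) one_pos)] with N hN
    exact χ.one_of_mem_closedBall hN
  obtain ⟨C, hC⟩ : ∃ C, ∀ x, ‖fderiv ℝ χ x‖ ≤ C :=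
    (χ.hasCompactSupport.fderiv (𝕜 := ℝ)).exists_bound_of_continuous
      (hχs.continuous_fderiv (by simp))
  have hηd : ∀ N x, fderiv ℝ (η N) x = c N • fderiv ℝ χ (c N • x) := by
    intro N x
    exact fderiv_comp_smul (𝕜 := ℝ) (f := χ) (c N)
  have hC0 : 0 ≤ C := (norm_nonneg _).trans (hC 0)
  have hηdb : ∀ N x, |fderiv ℝ (η N) x (basisVec i)| ≤ c N * C := by
    intro N x
    refine (ContinuousLinearMap.le_opNorm (fderiv ℝ (η N) x) (basisVec i)).trans ?_
    rw [hηd, norm_smul, Real.norm_of_nonneg (hc0 N).le, PiLp.norm_single, norm_one,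
      mul_one]
    exact mul_le_mul_of_nonneg_left (hC _) (hc0 N).le
  let φ : ℕ → 𝓓((⊤ : Opens (Euc n)), ℝ) := fun N =>
    testOfContDiff (fun x => η N x * ψ x) ((hηs N).mul hψs) ((hηc N).mul_right)
  have hφ : ∀ N x, φ N x = η N x * ψ x := fun _ _ => rfl
  have hφd : ∀ N x, fderiv ℝ (φ N) x (basisVec i) =
      η N x * fderiv ℝ ψ x (basisVec i) + fderiv ℝ (η N) x (basisVec i) * ψ x := by
    intro N x
    have e : (φ N : Euc n → ℝ) = fun x => η N x * ψ x := rfl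
    rw [e, fderiv_fun_mul ((hηs N).differentiable (by simp) x) ψ.differentiableAt]
    simp [mul_comm]
  have hu := memLp_two_top u
  have hw := memLp_two_top w
  have hψL : MemLp ψ 2 (volume : Measure (Euc n)) := ψ.memLp 2
  have hψ'L : MemLp (fun x => fderiv ℝ ψ x (basisVec i)) 2 (volume : Measure (Euc n)) := by
    have e : (fun x => fderiv ℝ ψ x (basisVec i)) = (∂_{basisVec i} ψ : 𝓢(Euc n, ℝ)) := rfl
    rw [e]
    exact (∂_{basisVec i} ψ : 𝓢(Euc n, ℝ)).memLp 2
  have int : ∀ {a : Euc n → ℝ} {b : Euc n → V}, MemLp a 2 volume → MemLp b 2 volume →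
      Integrable (fun x => a x • b x) volume := fun ha hb =>
    memLp_one_iff_integrable.1 (hb.smul ha)
  have hlim1 : Tendsto (fun N => ∫ x, fderiv ℝ (φ N) x (basisVec i) • u x) atTop
      (𝓝 (∫ x, fderiv ℝ ψ x (basisVec i) • u x)) := by
    refine tendsto_integral_of_dominated_convergence
      (fun x => ‖fderiv ℝ ψ x (basisVec i) • u x‖ + C * ‖ψ x • u x‖) ?_ ?_ ?_ ?_
    · intro N
      refine AEStronglyMeasurable.smul ?_ hu.1
      exact (((φ N).contDiff.continuous_fderiv (by simp)).clm_apply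
        continuous_const).aestronglyMeasurable
    · exact (int hψ'L hu).norm.add ((int hψL hu).norm.const_mul C)
    · intro N
      filter_upwards with x
      rw [hφd, add_smul, mul_smul, mul_smul]
      refine (norm_add_le _ _).trans (add_le_add ?_ ?_)
      · rw [norm_smul]
        exact mul_le_of_le_one_left (norm_nonneg _) (hη1 N x)
      · rw [norm_smul]
        refine mul_le_mul_of_nonneg_right ((hηdb N x).trans ?_) (norm_nonneg _)
        exact mul_le_of_le_one_left hC0 (hc1 N)
    · filter_upwards with x
      have h1 : Tendsto (fun N => η N x) atTop (𝓝 1) :=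
        tendsto_const_nhds.congr' ((hηlim x).mono fun N hN => hN.symm)
      have h2 : Tendsto (fun N => fderiv ℝ (η N) x (basisVec i)) atTop (𝓝 0) :=
        squeeze_zero_norm (fun N => hηdb N x) (by simpa using hcl.mul_const C)
      have h3 := (h1.mul_const (fderiv ℝ ψ x (basisVec i))).add (h2.mul_const (ψ x))
      simp only [← hφd, one_mul, zero_mul, add_zero] at h3
      exact h3.smul_const _
  have hlim2 : Tendsto (fun N => ∫ x, φ N x • w x) atTop (𝓝 (∫ x, ψ x • w x)) := by
    refine tendsto_integral_of_dominated_convergence (fun x => ‖ψ x • w x‖) ?_ ?_ ?_ ?_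
    · intro N
      exact (φ N).continuous.aestronglyMeasurable.smul hw.1
    · exact (int hψL hw).norm
    · intro N
      filter_upwards with x
      rw [hφ, mul_smul, norm_smul]
      exact mul_le_of_le_one_left (norm_nonneg _) (hη1 N x)
    · filter_upwards with x
      refine tendsto_const_nhds.congr' ((hηlim x).mono fun N hN => ?_)
      simp only [hφ, hN, one_mul]
  refine tendsto_nhds_unique hlim1 (hlim2.neg.congr fun N => ?_)
  exact (isWeakPartial_top_iff.1 h (φ N)).symm

/-- Weak partial derivatives may be tested against complex Schwartz functions. -/
lemma IsWeakPartial.integral_schwartz_complex {i : Fin n} {u w : L2 (⊤ : Opens (Euc n)) ℂ}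
    (h : IsWeakPartial i u w) (ψ : 𝓢(Euc n, ℂ)) :
    ∫ x, (∂_{basisVec i} ψ : 𝓢(Euc n, ℂ)) x • u x = -∫ x, ψ x • w x := by
  have hu := memLp_two_top u
  have hw := memLp_two_top w
  let a : 𝓢(Euc n, ℝ) := ψ.postcompCLM Complex.reCLM
  let b : 𝓢(Euc n, ℝ) := ψ.postcompCLM Complex.imCLM
  have int : ∀ (g : 𝓢(Euc n, ℝ)) {v : Euc n → ℂ}, MemLp v 2 volume →
      Integrable (fun x => g x • v x) volume := fun g v hv =>
    memLp_one_iff_integrable.1 (hv.smul (g.memLp 2))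
  have ha := h.integral_schwartz a
  have hb := h.integral_schwartz b
  have da : ∀ x, fderiv ℝ a x (basisVec i) = (fderiv ℝ ψ x (basisVec i)).re := fun x => by
    have hd : HasFDerivAt a (Complex.reCLM.comp (fderiv ℝ ψ x)) x :=
      Complex.reCLM.hasFDerivAt.comp x (ψ.hasFDerivAt x)
    rw [hd.fderiv]
    rfl
  have db : ∀ x, fderiv ℝ b x (basisVec i) = (fderiv ℝ ψ x (basisVec i)).im := fun x => by
    have hd : HasFDerivAt b (Complex.imCLM.comp (fderiv ℝ ψ x)) x :=
      Complex.imCLM.hasFDerivAt.comp x (ψ.hasFDerivAt x)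
    rw [hd.fderiv]
    rfl
  have split : ∀ z v : ℂ, z • v = z.re • v + Complex.I • (z.im • v) := fun z v => by
    apply Complex.ext
    · simp [sub_eq_add_neg]
    · simp
  have e1 : ∫ x, (∂_{basisVec i} ψ : 𝓢(Euc n, ℂ)) x • u x =
      (∫ x, fderiv ℝ a x (basisVec i) • u x) +
        Complex.I • ∫ x, fderiv ℝ b x (basisVec i) • u x := by
    have ia : Integrable (fun x => fderiv ℝ a x (basisVec i) • u x) volume :=
      int (∂_{basisVec i} a) hu
    have ib : Integrable (fun x => Complex.I • fderiv ℝ b x (basisVec i) • u x) volume :=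
      (int (∂_{basisVec i} b) hu).smul Complex.I
    rw [← integral_smul, ← integral_add ia ib]
    refine integral_congr_ae (Eventually.of_forall fun x => ?_)
    simp only [da, db]
    exact split _ _
  have e2 : ∫ x, ψ x • w x = (∫ x, a x • w x) + Complex.I • ∫ x, b x • w x := by
    have ib : Integrable (fun x => Complex.I • b x • w x) volume := (int b hw).smul Complex.I
    rw [← integral_smul, ← integral_add (int a hw) ib]
    exact integral_congr_ae (Eventually.of_forall fun x => split _ _)
  rw [e1, e2, ha, hb, smul_neg]
  ring

end SchwartzTests

/-! ### The inverse Fourier transform of a weak derivative -/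

section Hat

variable {n : ℕ}

/-- The inverse Fourier transform on complex `L²` functions on the whole space. -/
def hat : L2 (⊤ : Opens (Euc n)) ℂ →ₗᵢ[ℂ] Lp (α := Euc n) ℂ 2 :=
  ((Lp.fourierTransformₗᵢ (Euc n) ℂ).symm.toLinearIsometry).comp
    -- The restriction of `volume` to `⊤` equals `volume`, but the two `Lp` types differ; the
    -- identity map transports between them.
    (Lp.compMeasurePreservingₗᵢ ℂ (id : Euc n → Euc n)
      ⟨measurable_id, by rw [Measure.map_id, restrict_top_eq]⟩)

/-- An `L²` function on the whole space, without the restriction of the measure. -/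
def toFull (u : L2 (⊤ : Opens (Euc n)) ℂ) : Lp (α := Euc n) ℂ 2 := (memLp_two_top u).toLp u

lemma hat_eq (u : L2 (⊤ : Opens (Euc n)) ℂ) : hat u = 𝓕⁻ (toFull u) := by
  refine congrArg (Lp.fourierTransformₗᵢ (Euc n) ℂ).symm ?_
  refine Lp.ext ?_
  refine (Lp.coeFn_compMeasurePreserving _ _).trans ?_
  exact ((memLp_two_top u).coeFn_toLp).symm

/-- Testing against Schwartz functions identifies the weak derivative with the derivative of
tempered distributions, which the inverse Fourier transform turns into multiplication by `-2πi ξ_i`.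
-/
lemma IsWeakPartial.hat_ae_eq {i : Fin n} {u w : L2 (⊤ : Opens (Euc n)) ℂ}
    (h : IsWeakPartial i u w) :
    ∀ᵐ ξ ∂(volume : Measure (Euc n)),
      hat w ξ = -(2 * Real.pi * Complex.I) * (ξ i : ℂ) * hat u ξ := by
  have hd : ∂_{basisVec i} (toFull u : 𝓢'(Euc n, ℂ)) = (toFull w : 𝓢'(Euc n, ℂ)) := by
    ext ψ
    rw [TemperedDistribution.lineDerivOp_apply_apply, Lp.toTemperedDistribution_apply,
      Lp.toTemperedDistribution_apply]
    have key := h.integral_schwartz_complex ψ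
    have e1 : ∫ x, (-∂_{basisVec i} ψ : 𝓢(Euc n, ℂ)) x • toFull u x =
        -∫ x, (∂_{basisVec i} ψ : 𝓢(Euc n, ℂ)) x • u x := by
      rw [← integral_neg]
      refine integral_congr_ae ?_
      filter_upwards [(memLp_two_top u).coeFn_toLp] with x hx
      rw [toFull, hx]
      exact neg_smul _ _
    have e2 : ∫ x, ψ x • toFull w x = ∫ x, ψ x • w x := by
      refine integral_congr_ae ?_
      filter_upwards [(memLp_two_top w).coeFn_toLp] with x hx
      rw [toFull, hx]
    rw [e1, e2, key, neg_neg]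
  have hF := congrArg (fun T : 𝓢'(Euc n, ℂ) => 𝓕⁻ T) hd
  simp only [TemperedDistribution.fourierInv_lineDerivOp_eq,
    Lp.fourierInv_toTemperedDistribution_eq, ← hat_eq] at hF
  have hlu : LocallyIntegrable (hat u) (volume : Measure (Euc n)) :=
    (Lp.memLp (hat u)).locallyIntegrable (by norm_num)
  have hlw : LocallyIntegrable (hat w) (volume : Measure (Euc n)) :=
    (Lp.memLp (hat w)).locallyIntegrable (by norm_num)
  have hm : LocallyIntegrable
      (fun ξ : Euc n => (-(2 * Real.pi * Complex.I) * (ξ i : ℂ)) • hat u ξ) volume := by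
    have hc : Continuous fun ξ : Euc n => -(2 * Real.pi * Complex.I) * (ξ i : ℂ) := by fun_prop
    exact locallyIntegrableOn_univ.1 ((locallyIntegrableOn_univ.2 hlu).continuousOn_smul
      isOpen_univ.isLocallyClosed hc.continuousOn)
  -- The identity of distributions becomes one of functions almost everywhere, since both sides are
  -- locally integrable and compactly supported smooth tests separate them.
  refine ae_eq_of_integral_contDiff_smul_eq hlw hm fun g hg hgc => ?_
  let ψ : 𝓢(Euc n, ℂ) := (hgc.toSchwartzMap hg).postcompCLM Complex.ofRealCLM
  have hFψ := DFunLike.congr_fun hF ψ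
  have hi : (fun ξ : Euc n => ((inner ℝ ξ (basisVec i) : ℝ) : ℂ)).HasTemperateGrowth := by fun_prop
  have hψ : ∀ ξ, ψ ξ = ((g ξ : ℝ) : ℂ) := fun _ => rfl
  simp [hi, SchwartzMap.smulLeftCLM_apply_apply, hψ] at hFψ
  simp only [Complex.real_smul]
  rw [← hFψ, ← integral_const_mul, ← integral_neg]
  refine integral_congr_ae (Eventually.of_forall fun ξ => ?_)
  have e : inner ℝ ξ (basisVec i) = ξ i := by simp [EuclideanSpace.inner_single_right]
  simp only [e]
  ring

end Hat

end SobolevComp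

end

noncomputable section

namespace SobolevComp

open scoped SchwartzMap FourierTransform LineDeriv
open Filter Topology

/-! ### Equivalence of the Sobolev norm with a weighted norm on the Fourier side -/

section Weight

variable {n : ℕ}

/-- The Japanese bracket `(1 + |ξ|²)^{r/2}`. -/
def bracket (r : ℝ) (ξ : Euc n) : ℝ := (1 + ‖ξ‖ ^ 2) ^ (r / 2)

lemma bracket_pos (r : ℝ) (ξ : Euc n) : 0 < bracket r ξ := by
  unfold bracket
  positivity

lemma bracket_add (r r' : ℝ) (ξ : Euc n) : bracket (r + r') ξ = bracket r ξ * bracket r' ξ := by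
  unfold bracket
  rw [← Real.rpow_add (by positivity), add_div]

@[simp] lemma bracket_zero (ξ : Euc n) : bracket 0 ξ = 1 := by simp [bracket]

lemma bracket_mono {r r' : ℝ} (h : r ≤ r') (ξ : Euc n) : bracket r ξ ≤ bracket r' ξ :=
  Real.rpow_le_rpow_of_exponent_le (by nlinarith [sq_nonneg ‖ξ‖]) (by linarith)

lemma hasTemperateGrowth_bracket (r : ℝ) : (bracket r : Euc n → ℝ).HasTemperateGrowth :=
  Function.hasTemperateGrowth_one_add_norm_sq_rpow (Euc n) (r / 2)

lemma continuous_bracket (r : ℝ) : Continuous (bracket r : Euc n → ℝ) :=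
  (hasTemperateGrowth_bracket r).1.continuous

lemma bracket_one_eq (ξ : Euc n) : bracket 1 ξ = √(1 + ‖ξ‖ ^ 2) := by
  rw [bracket, Real.sqrt_eq_rpow]

lemma bracket_one_le (ξ : Euc n) : bracket 1 ξ ≤ 1 + ∑ i, |ξ i| := by
  have h0 : 0 ≤ ∑ i, |ξ i| := Finset.sum_nonneg fun _ _ => abs_nonneg _
  rw [bracket_one_eq, Real.sqrt_le_left (by positivity), EuclideanSpace.norm_sq_eq]
  have h := Finset.sum_sq_le_sq_sum_of_nonneg (s := Finset.univ) (f := fun i => |ξ i|)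
    fun _ _ => abs_nonneg _
  simp only [Real.norm_eq_abs]
  nlinarith

lemma abs_apply_le_bracket (ξ : Euc n) (i : Fin n) : |ξ i| ≤ bracket 1 ξ := by
  rw [bracket_one_eq]
  refine Real.le_sqrt_of_sq_le ?_
  have h : |ξ i| ≤ ‖ξ‖ := PiLp.norm_apply_le ξ i
  nlinarith [abs_nonneg (ξ i)]

/-- The weighted `L²` norm of the (inverse) Fourier transform. -/
def fourierNorm (r : ℝ) (u : L2 (⊤ : Opens (Euc n)) ℂ) : ℝ≥0∞ :=
  eLpNorm (fun ξ => bracket r ξ • hat u ξ) 2 (volume : Measure (Euc n))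

lemma aestronglyMeasurable_bracket_smul (r : ℝ) (u : L2 (⊤ : Opens (Euc n)) ℂ) :
    AEStronglyMeasurable (fun ξ => bracket r ξ • hat u ξ) (volume : Measure (Euc n)) :=
  (continuous_bracket r).aestronglyMeasurable.smul (Lp.aestronglyMeasurable _)

lemma fourierNorm_zero (u : L2 (⊤ : Opens (Euc n)) ℂ) : fourierNorm 0 u = ‖u‖ₑ := by
  simp only [fourierNorm, bracket_zero, one_smul]
  rw [← Lp.enorm_def, ← ofReal_norm, ← ofReal_norm, hat.norm_map]

lemma fourierNorm_mono {r r' : ℝ} (h : r ≤ r') (u : L2 (⊤ : Opens (Euc n)) ℂ) :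
    fourierNorm r u ≤ fourierNorm r' u := by
  refine eLpNorm_mono fun ξ => ?_
  rw [norm_smul, norm_smul, Real.norm_of_nonneg (bracket_pos r ξ).le,
    Real.norm_of_nonneg (bracket_pos r' ξ).le]
  exact mul_le_mul_of_nonneg_right (bracket_mono h ξ) (norm_nonneg _)

lemma IsWeakPartial.norm_hat_eq {i : Fin n} {u w : L2 (⊤ : Opens (Euc n)) ℂ}
    (h : IsWeakPartial i u w) : ∀ᵐ ξ ∂(volume : Measure (Euc n)),
      ‖hat w ξ‖ = 2 * Real.pi * (|ξ i| * ‖hat u ξ‖) := by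
  filter_upwards [h.hat_ae_eq] with ξ hξ
  rw [hξ]
  simp [abs_of_pos Real.pi_pos, mul_assoc]

/-- This rests on `|ξ_i| ≤ ⟨ξ⟩`; the converse direction, `fourierNorm_succ_le`, rests on `⟨ξ⟩ ≤ 1 +
∑ |ξ_i|`. -/
lemma fourierNorm_partial_le (r : ℝ) {i : Fin n} {u w : L2 (⊤ : Opens (Euc n)) ℂ}
    (h : IsWeakPartial i u w) :
    fourierNorm r w ≤ ENNReal.ofReal (2 * Real.pi) * fourierNorm (r + 1) u := by
  refine eLpNorm_le_mul_eLpNorm_of_ae_le_mul ?_ 2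
  filter_upwards [h.norm_hat_eq] with ξ hξ
  rw [norm_smul, norm_smul, hξ, Real.norm_of_nonneg (bracket_pos r ξ).le,
    Real.norm_of_nonneg (bracket_pos (r + 1) ξ).le, bracket_add]
  have h1 := mul_le_mul_of_nonneg_right (abs_apply_le_bracket ξ i) (norm_nonneg (hat u ξ))
  have h2 : 0 ≤ 2 * Real.pi * bracket r ξ :=
    mul_nonneg Real.two_pi_pos.le (bracket_pos r ξ).le
  calc _ = 2 * Real.pi * bracket r ξ * (|ξ i| * ‖hat u ξ‖) := by ring
    _ ≤ 2 * Real.pi * bracket r ξ * (bracket 1 ξ * ‖hat u ξ‖) :=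
        mul_le_mul_of_nonneg_left h1 h2
    _ = _ := by ring

lemma fourierNorm_succ_le (r : ℝ) {u : L2 (⊤ : Opens (Euc n)) ℂ}
    {w : Fin n → L2 (⊤ : Opens (Euc n)) ℂ} (h : ∀ i, IsWeakPartial i u (w i)) :
    fourierNorm (r + 1) u ≤ fourierNorm r u + ∑ i, fourierNorm r (w i) := by
  have hpt : ∀ᵐ ξ ∂(volume : Measure (Euc n)), ‖bracket (r + 1) ξ • hat u ξ‖ ≤
      ‖‖bracket r ξ • hat u ξ‖ + ∑ i, ‖bracket r ξ • hat (w i) ξ‖‖ := by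
    filter_upwards [ae_all_iff.2 fun i => (h i).norm_hat_eq] with ξ hξ
    have hb := (bracket_pos r ξ).le
    rw [Real.norm_of_nonneg (add_nonneg (norm_nonneg _)
      (Finset.sum_nonneg fun _ _ => norm_nonneg _))]
    simp only [norm_smul, hξ, Real.norm_of_nonneg (bracket_pos _ ξ).le]
    rw [bracket_add]
    have h1 := mul_le_mul_of_nonneg_left
      (mul_le_mul_of_nonneg_right (bracket_one_le ξ) (norm_nonneg (hat u ξ))) hb
    refine (le_of_eq (by ring)).trans (h1.trans ?_)
    rw [add_mul, one_mul, mul_add, Finset.sum_mul, Finset.mul_sum]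
    refine add_le_add_right (Finset.sum_le_sum fun i _ => mul_le_mul_of_nonneg_left ?_ hb) _
    have : 0 ≤ |ξ i| * ‖hat u ξ‖ := by positivity
    -- The factor `2π ≥ 1` in the transform of the partial derivative is simply discarded.
    nlinarith [Real.pi_gt_three]
  refine (eLpNorm_mono_ae hpt).trans ?_
  refine (eLpNorm_add_le (aestronglyMeasurable_bracket_smul r u).norm ?_ (by norm_num)).trans ?_
  · exact Finset.aestronglyMeasurable_fun_sum _ fun i _ =>
      (aestronglyMeasurable_bracket_smul r (w i)).norm
  · rw [eLpNorm_norm]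
    refine add_le_add_right ?_ _
    have e : (fun ξ => ∑ i, ‖bracket r ξ • hat (w i) ξ‖) =
        ∑ i, fun ξ => ‖bracket r ξ • hat (w i) ξ‖ := by
      ext ξ
      simp
    rw [e]
    refine (eLpNorm_sum_le (fun i _ => (aestronglyMeasurable_bracket_smul r (w i)).norm)
      (by norm_num)).trans (Finset.sum_le_sum fun i _ => ?_)
    rw [eLpNorm_norm]
    exact le_rfl

-- Together with `exists_le_fourierNorm` this is the norm equivalence for integer orders, obtained
-- by applying the one-step comparisons once per derivative. It reduces density and products to
-- weighted `L²` statements.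
open Sobolev in
lemma exists_fourierNorm_le (s : ℕ) : ∃ C : ℝ≥0∞, C ≠ ⊤ ∧
    ∀ u : Sobolev s (⊤ : Opens (Euc n)) ℂ, fourierNorm s (toL2 u) ≤ C * ‖u‖ₑ := by
  induction s with
  | zero =>
    refine ⟨1, ENNReal.one_ne_top, fun u => ?_⟩
    rw [Nat.cast_zero, fourierNorm_zero, one_mul, ← ofReal_norm, ← ofReal_norm]
    exact ENNReal.ofReal_le_ofReal (norm_toL2_le u)
  | succ s ih =>
    obtain ⟨C, hC, h⟩ := ih
    let c (T : Sobolev (s + 1) (⊤ : Opens (Euc n)) ℂ →L[ℝ] Sobolev s (⊤ : Opens (Euc n)) ℂ) :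
      ℝ≥0∞ := C * ‖T‖ₑ
    have hc : ∀ T, c T ≠ ⊤ := fun T => ENNReal.mul_ne_top hC (by simp)
    have hT : ∀ T u, fourierNorm s (toL2 (T u)) ≤ c T * ‖u‖ₑ := fun T u => by
      refine (h (T u)).trans ?_
      rw [mul_assoc]
      gcongr
      exact T.le_opENorm u
    refine ⟨c (incl (Nat.le_succ s)) + ∑ i, c (partialCLM i), ?_, fun u => ?_⟩
    · exact ENNReal.add_ne_top.2 ⟨hc _, ENNReal.sum_ne_top.2 fun i _ => hc _⟩
    · rw [Nat.cast_add, Nat.cast_one]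
      refine (fourierNorm_succ_le s fun i => isWeakPartial_partialCLM i u).trans ?_
      rw [add_mul, Finset.sum_mul]
      gcongr with i
      · exact hT (incl (Nat.le_succ s)) u
      · exact hT _ u

open Sobolev in
lemma exists_le_fourierNorm (s : ℕ) : ∃ C : ℝ≥0∞, C ≠ ⊤ ∧
    ∀ u : Sobolev s (⊤ : Opens (Euc n)) ℂ, ‖u‖ₑ ≤ C * fourierNorm s (toL2 u) := by
  induction s with
  | zero =>
    refine ⟨Fintype.card (Index 0 n), by simp, fun u => ?_⟩
    rw [Nat.cast_zero, fourierNorm_zero]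
    have := ENNReal.ofReal_le_ofReal (norm_zero_order_le u)
    rwa [ENNReal.ofReal_mul (by positivity), ENNReal.ofReal_natCast, ofReal_norm,
      ofReal_norm] at this
  | succ s ih =>
    obtain ⟨C, hC, h⟩ := ih
    refine ⟨Fintype.card (Index (s + 1) n) * (1 + ∑ i : Fin n, C * ENNReal.ofReal (2 * Real.pi)),
      ?_, fun u => ?_⟩
    · refine ENNReal.mul_ne_top (by simp) (ENNReal.add_ne_top.2 ⟨by simp, ?_⟩)
      exact ENNReal.sum_ne_top.2 fun i _ => ENNReal.mul_ne_top hC ENNReal.ofReal_ne_top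
    · have := ENNReal.ofReal_le_ofReal (norm_succ_le u)
      rw [ENNReal.ofReal_mul (by positivity), ENNReal.ofReal_natCast, ofReal_norm,
        ENNReal.ofReal_add (norm_nonneg _) (Finset.sum_nonneg fun _ _ => norm_nonneg _),
        ofReal_norm, ENNReal.ofReal_sum_of_nonneg fun _ _ => norm_nonneg _] at this
      refine this.trans ?_
      rw [mul_assoc, add_mul, one_mul, Finset.sum_mul]
      gcongr with i
      · rw [← fourierNorm_zero]
        exact fourierNorm_mono (by positivity) _
      · rw [ofReal_norm]
        refine (h _).trans ?_
        rw [mul_assoc, Nat.cast_add, Nat.cast_one]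
        gcongr
        exact fourierNorm_partial_le s (isWeakPartial_partialCLM i u)

end Weight

/-! ### Density of Schwartz functions -/

section Schwartz

variable {n : ℕ} {V : Type*} [NormedAddCommGroup V] [NormedSpace ℝ V] [CompleteSpace V]

/-- A Schwartz function as an element of `L²`. -/
def schwartzL2 (φ : 𝓢(Euc n, V)) : L2 (⊤ : Opens (Euc n)) V :=
  MemLp.toLp φ ((φ.memLp 2 volume).mono_measure Measure.restrict_le_self)

lemma coeFn_schwartzL2 (φ : 𝓢(Euc n, V)) :
    schwartzL2 φ =ᵐ[(volume : Measure (Euc n))] φ := by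
  exact ae_top_iff.1 (MemLp.coeFn_toLp _)

lemma isWeakPartial_schwartzL2 (i : Fin n) (φ : 𝓢(Euc n, V)) :
    IsWeakPartial i (schwartzL2 φ) (schwartzL2 (∂_{basisVec i} φ)) := by
  refine isWeakPartial_top_iff.2 fun χ => ?_
  have e1 : ∫ x, fderiv ℝ χ x (basisVec i) • schwartzL2 φ x =
      ∫ x, fderiv ℝ χ x (basisVec i) • φ x := by
    refine integral_congr_ae ?_
    filter_upwards [coeFn_schwartzL2 φ] with x hx
    rw [hx]
  have e2 : ∫ x, χ x • schwartzL2 (∂_{basisVec i} φ) x =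
      ∫ x, χ x • fderiv ℝ φ x (basisVec i) := by
    refine integral_congr_ae ?_
    filter_upwards [coeFn_schwartzL2 (∂_{basisVec i} φ)] with x hx
    rw [hx]
    rfl
  let χ' : 𝓢(Euc n, ℝ) := χ.hasCompactSupport.toSchwartzMap χ.contDiff
  have int : ∀ (a : 𝓢(Euc n, ℝ)) (b : 𝓢(Euc n, V)), Integrable (fun x => a x • b x) volume :=
    fun a b => memLp_one_iff_integrable.1 ((b.memLp 2).smul (a.memLp 2))
  rw [e1, e2, integral_smul_fderiv_eq_neg_fderiv_smul_of_integrable (f := χ) (g := φ)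
    (int (∂_{basisVec i} χ') φ) (int χ' (∂_{basisVec i} φ)) (int χ' φ)
    (fun x _ => χ'.differentiableAt) (fun x _ => φ.differentiableAt), neg_neg]

lemma schwartzL2_mem (s : ℕ) (φ : 𝓢(Euc n, V)) :
    schwartzL2 φ ∈ sobolevSubmodule s (⊤ : Opens (Euc n)) V := by
  induction s generalizing φ with
  | zero => exact Sobolev.mem_zero _
  | succ s ih =>
    exact Sobolev.mem_succ (fun i => Sobolev.ofMem _ (ih (∂_{basisVec i} φ)))
      fun i => isWeakPartial_schwartzL2 i φ

/-- A Schwartz function as an element of a Sobolev space. -/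
def schwartzSobolev (s : ℕ) (φ : 𝓢(Euc n, V)) : Sobolev s (⊤ : Opens (Euc n)) V :=
  Sobolev.ofMem (schwartzL2 φ) (schwartzL2_mem s φ)

@[simp] lemma toL2_schwartzSobolev (s : ℕ) (φ : 𝓢(Euc n, V)) :
    Sobolev.toL2 (schwartzSobolev s φ) = schwartzL2 φ := rfl

lemma hat_schwartzL2 (φ : 𝓢(Euc n, ℂ)) :
    hat (schwartzL2 φ) =ᵐ[(volume : Measure (Euc n))] (𝓕⁻ φ : 𝓢(Euc n, ℂ)) := by
  have e : toFull (schwartzL2 φ) = φ.toLp 2 := by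
    refine Lp.ext ?_
    exact (MemLp.coeFn_toLp _).trans ((coeFn_schwartzL2 φ).trans (φ.coeFn_toLp 2 volume).symm)
  rw [hat_eq, e, SchwartzMap.toLp_fourierInv_eq]
  exact SchwartzMap.coeFn_toLp _ 2 volume

/-- Schwartz functions are dense in complex Sobolev spaces. -/
lemma denseRange_schwartzSobolev_complex (s : ℕ) :
    DenseRange (schwartzSobolev s : 𝓢(Euc n, ℂ) → Sobolev s (⊤ : Opens (Euc n)) ℂ) := by
  obtain ⟨C, hC, hle⟩ := exists_fourierNorm_le (n := n) s
  obtain ⟨D, hD, hge⟩ := exists_le_fourierNorm (n := n) s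
  intro u
  have hfin : fourierNorm s (Sobolev.toL2 u) < ⊤ :=
    (hle u).trans_lt (ENNReal.mul_lt_top hC.lt_top (by simp))
  let v : Lp (α := Euc n) ℂ 2 :=
    MemLp.toLp (fun ξ => bracket s ξ • hat (Sobolev.toL2 u) ξ)
      ⟨aestronglyMeasurable_bracket_smul s _, hfin⟩
  have hv : v =ᵐ[volume] fun ξ => bracket s ξ • hat (Sobolev.toL2 u) ξ := MemLp.coeFn_toLp _
  rw [EMetric.mem_closure_iff]
  intro ε hε
  -- Dividing by `D + 1` instead of `D` keeps the divisor nonzero.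
  have hδ : 0 < ε / (D + 1) := ENNReal.div_pos hε.ne' (ENNReal.add_ne_top.2 ⟨hD, by simp⟩)
  obtain ⟨_, ⟨h, rfl⟩, hh⟩ := EMetric.mem_closure_iff.1
    (SchwartzMap.denseRange_toLpCLM (E := Euc n) (F := ℂ) (p := 2) (μ := volume)
      ENNReal.ofNat_ne_top v) (ε / (D + 1)) hδ
  -- If `h` approximates `⟨ξ⟩^s û` in `L²`, then undoing the weight and the transform gives a
  -- Schwartz function whose weighted distance to `u` is exactly the `L²` distance from `v` to `h`.
  let φ : 𝓢(Euc n, ℂ) := 𝓕 (SchwartzMap.smulLeftCLM ℂ (bracket (-(s : ℝ))) h)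
  refine ⟨_, ⟨φ, rfl⟩, ?_⟩
  rw [edist_eq_enorm_sub] at hh ⊢
  have key : fourierNorm s (Sobolev.toL2 (u - schwartzSobolev s φ)) = ‖v - h.toLp 2 volume‖ₑ := by
    rw [Lp.enorm_def, fourierNorm]
    refine eLpNorm_congr_ae ?_
    rw [map_sub, map_sub, toL2_schwartzSobolev]
    filter_upwards [hv, Lp.coeFn_sub v (h.toLp 2 volume), h.coeFn_toLp 2 volume, hat_schwartzL2 φ,
      Lp.coeFn_sub (hat (Sobolev.toL2 u)) (hat (schwartzL2 φ))] with ξ h1 h2 h3 h4 h5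
    rw [h2, h5, Pi.sub_apply, Pi.sub_apply, h1, h3, h4, smul_sub]
    congr 1
    simp only [φ, FourierTransform.fourierInv_fourier_eq]
    rw [SchwartzMap.smulLeftCLM_apply_apply (hasTemperateGrowth_bracket _), smul_smul,
      ← bracket_add]
    simp
  refine (hge _).trans_lt ?_
  rw [key]
  have h1 : D * ‖v - h.toLp 2 volume‖ₑ ≤ (D + 1) * ‖v - h.toLp 2 volume‖ₑ := by
    gcongr
    exact le_self_add
  refine h1.trans_lt ?_
  rw [mul_comm]
  exact (ENNReal.lt_div_iff_mul_lt (Or.inl (by simp)) (Or.inl (ENNReal.add_ne_top.2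
    ⟨hD, by simp⟩))).1 hh

/-- Schwartz functions are dense in real Sobolev spaces. -/
lemma denseRange_schwartzSobolev (s : ℕ) :
    DenseRange (schwartzSobolev s : 𝓢(Euc n, ℝ) → Sobolev s (⊤ : Opens (Euc n)) ℝ) := by
  let R : Sobolev s (⊤ : Opens (Euc n)) ℂ →L[ℝ] Sobolev s (⊤ : Opens (Euc n)) ℝ :=
    Sobolev.mapCLM Complex.reCLM
  -- Taking real parts is bounded and onto, so it carries a dense set to a dense set, and it
  -- preserves Schwartz functions.
  have hR : Function.Surjective R := fun u => by
    refine ⟨Sobolev.mapCLM Complex.ofRealCLM u, Sobolev.ext_ae ?_⟩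
    filter_upwards [Sobolev.coeFn_mapCLM Complex.reCLM (Sobolev.mapCLM Complex.ofRealCLM u),
      Sobolev.coeFn_mapCLM Complex.ofRealCLM u] with x h1 h2
    rw [h1, h2]
    simp
  have hd := (hR.denseRange.comp (denseRange_schwartzSobolev_complex s) R.continuous)
  refine hd.mono ?_
  rintro _ ⟨φ, rfl⟩
  refine ⟨φ.postcompCLM Complex.reCLM, Sobolev.ext_ae ?_⟩
  have h1 := ae_restrict_of_ae (s := ((⊤ : Opens (Euc n)) : Set (Euc n)))
    (coeFn_schwartzL2 (φ.postcompCLM Complex.reCLM))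
  have h2 := ae_restrict_of_ae (s := ((⊤ : Opens (Euc n)) : Set (Euc n))) (coeFn_schwartzL2 φ)
  filter_upwards [h1, h2, Sobolev.coeFn_mapCLM Complex.reCLM (schwartzSobolev s φ)] with x a b c
  rw [Function.comp_apply, c, toL2_schwartzSobolev, toL2_schwartzSobolev, a, b]
  rfl

end Schwartz

end SobolevComp

end

noncomputable section

namespace SobolevComp

open scoped SchwartzMap FourierTransform LineDeriv Convolution
open Filter Topology

/-! ### Young's inequality and its weighted form -/

section Young

lemma sq_lintegral_mul_le {α : Type*} [MeasurableSpace α] (μ : Measure α) {f g : α → ℝ≥0∞}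
    (hf : AEMeasurable f μ) (hg : AEMeasurable g μ) :
    (∫⁻ a, f a * g a ∂μ) ^ 2 ≤ (∫⁻ a, f a ^ 2 ∂μ) * ∫⁻ a, g a ^ 2 ∂μ := by
  have h := ENNReal.lintegral_mul_le_Lp_mul_Lq μ Real.HolderConjugate.two_two hf hg
  simp only [Pi.mul_apply, ENNReal.rpow_two] at h
  refine (pow_le_pow_left₀ zero_le h 2).trans (le_of_eq ?_)
  rw [mul_pow, ← ENNReal.rpow_two, ← ENNReal.rpow_two, ← ENNReal.rpow_mul, ← ENNReal.rpow_mul]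
  norm_num

lemma ennreal_add_sq_le (a b : ℝ≥0∞) : (a + b) ^ 2 ≤ 4 * (a ^ 2 + b ^ 2) := by
  have h : a + b ≤ 2 * max a b := by
    rw [two_mul]
    exact add_le_add (le_max_left a b) (le_max_right a b)
  refine (pow_le_pow_left₀ zero_le h 2).trans ?_
  rw [mul_pow]
  norm_num
  gcongr
  rcases le_total a b with hab | hab
  · rw [max_eq_right hab]
    exact le_add_self
  · rw [max_eq_left hab]
    exact le_self_add

variable {n : ℕ}

/-- Young's inequality `‖f ⋆ g‖₂ ≤ ‖f‖₁ ‖g‖₂`. -/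
lemma lintegral_sq_conv_le {f g : Euc n → ℝ≥0∞} (hf : Measurable f) (hg : Measurable g) :
    ∫⁻ x, (∫⁻ y, f y * g (x - y)) ^ 2 ≤ (∫⁻ y, f y) ^ 2 * ∫⁻ y, g y ^ 2 := by
  have h1 : ∀ x, (∫⁻ y, f y * g (x - y)) ^ 2 ≤ (∫⁻ y, f y) * ∫⁻ y, f y * g (x - y) ^ 2 := by
    intro x
    have hgx : Measurable fun y => g (x - y) := hg.comp (measurable_const.sub measurable_id)
    -- Cauchy–Schwarz for the measure `f dy` applied to `1` and `g (x - ·)`; Tonelli then integrates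
    -- in `x`.
    have h := sq_lintegral_mul_le (volume.withDensity f) (f := fun _ => (1 : ℝ≥0∞))
      measurable_const.aemeasurable hgx.aemeasurable
    simp only [one_mul, one_pow] at h
    rw [lintegral_withDensity_eq_lintegral_mul _ hf hgx,
      lintegral_withDensity_eq_lintegral_mul _ hf (hgx.pow_const 2),
      lintegral_withDensity_eq_lintegral_mul _ hf measurable_const] at h
    simpa using h
  refine (lintegral_mono h1).trans ?_
  have hm : Measurable fun p : Euc n × Euc n => f p.2 * g (p.1 - p.2) ^ 2 :=
    (hf.comp measurable_snd).mul ((hg.comp (measurable_fst.sub measurable_snd)).pow_const 2)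
  have hin : ∀ y, ∫⁻ x, f y * g (x - y) ^ 2 = f y * ∫⁻ x, g x ^ 2 := fun y => by
    have hm' : Measurable fun x => g (x - y) ^ 2 :=
      (hg.comp (measurable_id.sub_const y)).pow_const 2
    rw [lintegral_const_mul _ hm']
    congr 1
    exact lintegral_sub_right_eq_self (fun x => g x ^ 2) y
  rw [lintegral_const_mul _ hm.lintegral_prod_right', lintegral_lintegral_swap hm.aemeasurable]
  simp only [hin]
  rw [lintegral_mul_const _ hf, sq, mul_assoc]

lemma lintegral_conv_comm (f g : Euc n → ℝ≥0∞) (x : Euc n) :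
    ∫⁻ y, f y * g (x - y) = ∫⁻ y, g y * f (x - y) := by
  rw [← lintegral_sub_left_eq_self (fun y => f y * g (x - y)) x]
  simp [mul_comm]

/-- The square integral of the weight `⟨ξ⟩^{-σ}`. -/
def weightConst (n : ℕ) (σ : ℝ) : ℝ≥0∞ :=
  ∫⁻ ξ : Euc n, ENNReal.ofReal (bracket (-σ) ξ) ^ 2

/-- The integrand is `(1 + |ξ|²)^{-σ}`. The threshold `s + t > n/2` of the product estimate comes
from here, with `σ = s + t`. -/
lemma weightConst_ne_top {σ : ℝ} (h : n < 2 * σ) : weightConst n σ ≠ ⊤ := by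
  have hi := integrable_rpow_neg_one_add_norm_sq (E := Euc n) (μ := volume) (r := 2 * σ)
    (by simpa using h)
  refine ne_of_lt (lt_of_le_of_lt (le_of_eq ?_) hi.lintegral_lt_top)
  refine lintegral_congr fun ξ => ?_
  rw [← ENNReal.ofReal_pow (bracket_pos _ ξ).le, sq, ← bracket_add]
  congr 2
  ring

/-- Whichever of `y`, `z` has the smaller norm has the larger negative power, so both factors can be
evaluated there. -/
lemma bracket_mul_le {s t : ℝ} (hs : 0 ≤ s) (ht : 0 ≤ t) (y z : Euc n) :
    bracket (-s) y * bracket (-t) z ≤ bracket (-(s + t)) y + bracket (-(s + t)) z := by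
  have mono : ∀ {r : ℝ} {y z : Euc n}, 0 ≤ r → ‖y‖ ≤ ‖z‖ → bracket (-r) z ≤ bracket (-r) y := by
    intro r y z hr h
    refine Real.rpow_le_rpow_of_nonpos (by positivity) ?_ (by linarith)
    gcongr
  have e : -(s + t) = -s + -t := by ring
  rw [e, bracket_add, bracket_add]
  rcases le_total ‖y‖ ‖z‖ with h | h
  · have := mul_le_mul_of_nonneg_left (mono ht h) (bracket_pos (-s) y).le
    have h2 := mul_pos (bracket_pos (-s) z) (bracket_pos (-t) z)
    linarith
  · have := mul_le_mul_of_nonneg_right (mono hs h) (bracket_pos (-t) z).le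
    have h2 := mul_pos (bracket_pos (-s) y) (bracket_pos (-t) y)
    linarith

/-- Weighted `L²` bound for convolutions. -/
lemma lintegral_sq_conv_le_weighted {s t : ℝ} (hs : 0 ≤ s) (ht : 0 ≤ t) {a b : Euc n → ℝ≥0∞}
    (ha : Measurable a) (hb : Measurable b) :
    ∫⁻ x, (∫⁻ y, a y * b (x - y)) ^ 2 ≤ 8 * weightConst n (s + t) *
      (∫⁻ y, (ENNReal.ofReal (bracket s y) * a y) ^ 2) *
      ∫⁻ y, (ENNReal.ofReal (bracket t y) * b y) ^ 2 := by
  let w : ℝ → Euc n → ℝ≥0∞ := fun r y => ENNReal.ofReal (bracket r y)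
  have hw : ∀ r, Measurable (w r) := fun r => (continuous_bracket r).measurable.ennreal_ofReal
  let A : Euc n → ℝ≥0∞ := fun y => w s y * a y
  let B : Euc n → ℝ≥0∞ := fun y => w t y * b y
  have hA : Measurable A := (hw s).mul ha
  have hB : Measurable B := (hw t).mul hb
  let σ := s + t
  let A' : Euc n → ℝ≥0∞ := fun y => A y * w (-σ) y
  let B' : Euc n → ℝ≥0∞ := fun y => B y * w (-σ) y
  have hA' : Measurable A' := hA.mul (hw _)
  have hB' : Measurable B' := hB.mul (hw _)
  have inv : ∀ r y, w (-r) y * w r y = 1 := fun r y => by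
    simp only [w]
    rw [← ENNReal.ofReal_mul (bracket_pos _ y).le, ← bracket_add]
    simp
  -- Inserting the weights and using `bracket_mul_le` puts the whole decay `⟨·⟩^{-σ}` on one factor.
  -- That factor is then integrable by Cauchy–Schwarz, and Young's inequality applies to each of the
  -- two terms.
  have pt : ∀ y z, a y * b z ≤ A' y * B z + A y * B' z := by
    intro y z
    have h := ENNReal.ofReal_le_ofReal (bracket_mul_le hs ht y z)
    rw [ENNReal.ofReal_mul (bracket_pos _ y).le, ENNReal.ofReal_add (bracket_pos _ _).le
      (bracket_pos _ _).le] at h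
    calc a y * b z = (w (-s) y * w s y) * (w (-t) z * w t z) * (a y * b z) := by
          rw [inv, inv]; simp
      _ = (w (-s) y * w (-t) z) * (A y * B z) := by simp only [A, B]; ring
      _ ≤ (w (-σ) y + w (-σ) z) * (A y * B z) := by gcongr
      _ = _ := by simp only [A', B']; ring
  have bd : ∀ {f : Euc n → ℝ≥0∞}, Measurable f → (∫⁻ y, f y * w (-σ) y) ^ 2 ≤
      (∫⁻ y, f y ^ 2) * weightConst n σ := fun hf =>
    sq_lintegral_mul_le volume hf.aemeasurable (hw _).aemeasurable
  have hx : ∀ x, (∫⁻ y, a y * b (x - y)) ^ 2 ≤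
      4 * ((∫⁻ y, A' y * B (x - y)) ^ 2 + (∫⁻ y, B' y * A (x - y)) ^ 2) := by
    intro x
    refine le_trans (pow_le_pow_left₀ zero_le ?_ 2) (ennreal_add_sq_le _ _)
    have hm' : Measurable fun y => A' y * B (x - y) :=
      hA'.mul (hB.comp (measurable_const.sub measurable_id))
    rw [lintegral_conv_comm B' A, ← lintegral_add_left hm']
    exact lintegral_mono fun y => pt y (x - y)
  have meas : ∀ {f g : Euc n → ℝ≥0∞}, Measurable f → Measurable g →
      Measurable fun x => (∫⁻ y, f y * g (x - y)) ^ 2 := fun hf hg =>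
    Measurable.pow_const (Measurable.lintegral_prod_right' (f := fun p : Euc n × Euc n => _)
      ((hf.comp measurable_snd).mul (hg.comp (measurable_fst.sub measurable_snd)))) 2
  refine (lintegral_mono hx).trans ?_
  have hm' : Measurable fun x =>
      (∫⁻ y, A' y * B (x - y)) ^ 2 + (∫⁻ y, B' y * A (x - y)) ^ 2 :=
    (meas hA' hB).add (meas hB' hA)
  rw [lintegral_const_mul _ hm', lintegral_add_left (meas hA' hB)]
  have h1 := (lintegral_sq_conv_le hA' hB).trans (mul_le_mul_left (bd hA) _)
  have h2 := (lintegral_sq_conv_le hB' hA).trans (mul_le_mul_left (bd hB) _)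
  -- The constant `8` is the `4` of `ennreal_add_sq_le` times two equal bounds.
  refine (mul_le_mul_right (add_le_add h1 h2) 4).trans (le_of_eq ?_)
  ring

end Young

/-! ### The product estimate in `L²` -/

section Product

variable {n : ℕ}

lemma eLpNorm_two_sq {α E : Type*} [MeasurableSpace α] {μ : Measure α} [NormedAddCommGroup E]
    (f : α → E) : eLpNorm f 2 μ ^ 2 = ∫⁻ x, ‖f x‖ₑ ^ 2 ∂μ := by
  have h := eLpNorm_nnreal_pow_eq_lintegral (f := f) (μ := μ) (p := 2) two_ne_zero
  simpa using h

lemma eLpNorm_fourier (φ : 𝓢(Euc n, ℂ)) :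
    eLpNorm (𝓕 φ : 𝓢(Euc n, ℂ)) 2 volume = eLpNorm φ 2 volume := by
  have h := SchwartzMap.norm_fourier_toL2_eq φ
  rw [SchwartzMap.norm_toLp, SchwartzMap.norm_toLp] at h
  exact (ENNReal.toReal_eq_toReal_iff' (SchwartzMap.memLp _ 2 volume).2.ne
    (φ.memLp 2 volume).2.ne).1 h

lemma fourierNorm_schwartz_sq (s : ℝ) (φ : 𝓢(Euc n, ℂ)) :
    fourierNorm s (schwartzL2 φ) ^ 2 =
      ∫⁻ ξ, (ENNReal.ofReal (bracket s ξ) * ‖(𝓕⁻ φ : 𝓢(Euc n, ℂ)) ξ‖ₑ) ^ 2 := by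
  rw [fourierNorm, eLpNorm_two_sq]
  refine lintegral_congr_ae ?_
  filter_upwards [hat_schwartzL2 φ] with ξ hξ
  rw [hξ, enorm_smul, ← ofReal_norm (bracket s ξ), Real.norm_of_nonneg (bracket_pos s ξ).le]

/-- The product estimate for complex Schwartz functions. -/
lemma eLpNorm_mul_schwartz_sq_le {s t : ℝ} (hs : 0 ≤ s) (ht : 0 ≤ t) (φ ψ : 𝓢(Euc n, ℂ)) :
    eLpNorm (fun x => φ x * ψ x) 2 volume ^ 2 ≤ 8 * weightConst n (s + t) *
      fourierNorm s (schwartzL2 φ) ^ 2 * fourierNorm t (schwartzL2 ψ) ^ 2 := by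
  let B := ContinuousLinearMap.mul ℂ ℂ
  let f : 𝓢(Euc n, ℂ) := 𝓕⁻ φ
  let g : 𝓢(Euc n, ℂ) := 𝓕⁻ ψ
  -- The product is the forward transform of the convolution of the inverse transforms, so
  -- Plancherel reduces the claim to the weighted convolution bound.
  have e : (fun x => φ x * ψ x) = (𝓕 (SchwartzMap.convolution B f g) : 𝓢(Euc n, ℂ)) := by
    rw [SchwartzMap.fourier_convolution]
    funext x
    simp [f, g, B, SchwartzMap.pairing_apply_apply]
  rw [e, eLpNorm_fourier, eLpNorm_two_sq, fourierNorm_schwartz_sq, fourierNorm_schwartz_sq]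
  refine le_trans (lintegral_mono fun x => ?_) (lintegral_sq_conv_le_weighted hs ht
    (a := fun ξ => ‖f ξ‖ₑ) (b := fun ξ => ‖g ξ‖ₑ)
    f.continuous.enorm.measurable g.continuous.enorm.measurable)
  refine pow_le_pow_left₀ zero_le ?_ 2
  rw [SchwartzMap.convolution_apply]
  refine (enorm_integral_le_lintegral_enorm _).trans (lintegral_mono fun y => ?_)
  simp [B, enorm_mul]

lemma exists_eLpNorm_mul_schwartz_le {s t : ℕ} (h : n < 2 * (s + t)) : ∃ C : ℝ≥0∞, C ≠ ⊤ ∧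
    ∀ φ ψ : 𝓢(Euc n, ℝ), eLpNorm (fun x => φ x * ψ x) 2 volume ≤
      C * ‖schwartzSobolev s φ‖ₑ * ‖schwartzSobolev t ψ‖ₑ := by
  obtain ⟨C₁, hC₁, h₁⟩ := exists_fourierNorm_le (n := n) s
  obtain ⟨C₂, hC₂, h₂⟩ := exists_fourierNorm_le (n := n) t
  have hK : weightConst n ((s : ℝ) + t) ≠ ⊤ := weightConst_ne_top (by exact_mod_cast h)
  let K : ℝ≥0∞ := (8 * weightConst n ((s : ℝ) + t)) ^ (1 / 2 : ℝ)
  have hKt : K ≠ ⊤ := ENNReal.rpow_ne_top_of_nonneg (by norm_num)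
    (ENNReal.mul_ne_top (by simp) hK)
  have hK2 : K ^ 2 = 8 * weightConst n ((s : ℝ) + t) := by
    rw [← ENNReal.rpow_two, ← ENNReal.rpow_mul]
    norm_num
  let T : ∀ r : ℕ, Sobolev r (⊤ : Opens (Euc n)) ℝ →L[ℝ] Sobolev r (⊤ : Opens (Euc n)) ℂ :=
    fun r => Sobolev.mapCLM Complex.ofRealCLM
  have hT : ∀ (r : ℕ) (φ : 𝓢(Euc n, ℝ)),
      T r (schwartzSobolev r φ) = schwartzSobolev r (φ.postcompCLM Complex.ofRealCLM) := by
    intro r φ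
    refine Sobolev.ext_ae ?_
    have h1 := ae_restrict_of_ae (s := ((⊤ : Opens (Euc n)) : Set (Euc n)))
      (coeFn_schwartzL2 (φ.postcompCLM Complex.ofRealCLM))
    have h2 := ae_restrict_of_ae (s := ((⊤ : Opens (Euc n)) : Set (Euc n))) (coeFn_schwartzL2 φ)
    filter_upwards [h1, h2, Sobolev.coeFn_mapCLM Complex.ofRealCLM (schwartzSobolev r φ)]
      with x a b c
    rw [c, toL2_schwartzSobolev, toL2_schwartzSobolev, a, b]
    rfl
  refine ⟨K * (C₁ * ‖T s‖ₑ) * (C₂ * ‖T t‖ₑ), ?_, fun φ ψ => ?_⟩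
  · exact ENNReal.mul_ne_top (ENNReal.mul_ne_top hKt (ENNReal.mul_ne_top hC₁ (by simp)))
      (ENNReal.mul_ne_top hC₂ (by simp))
  · let φ' : 𝓢(Euc n, ℂ) := φ.postcompCLM Complex.ofRealCLM
    let ψ' : 𝓢(Euc n, ℂ) := ψ.postcompCLM Complex.ofRealCLM
    have b1 : fourierNorm s (schwartzL2 φ') ≤ C₁ * ‖T s‖ₑ * ‖schwartzSobolev s φ‖ₑ := by
      have := h₁ (schwartzSobolev s φ')
      refine this.trans ?_
      rw [← hT, mul_assoc]
      gcongr
      exact (T s).le_opENorm _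
    have b2 : fourierNorm t (schwartzL2 ψ') ≤ C₂ * ‖T t‖ₑ * ‖schwartzSobolev t ψ‖ₑ := by
      have := h₂ (schwartzSobolev t ψ')
      refine this.trans ?_
      rw [← hT, mul_assoc]
      gcongr
      exact (T t).le_opENorm _
    have e : eLpNorm (fun x => φ x * ψ x) 2 volume = eLpNorm (fun x => φ' x * ψ' x) 2 volume := by
      refine eLpNorm_congr_norm_ae (Eventually.of_forall fun x => ?_)
      simp [φ', ψ']
    have key := eLpNorm_mul_schwartz_sq_le (s := s) (t := t) (by positivity) (by positivity) φ' ψ'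
    rw [← e, ← hK2, ← mul_pow, ← mul_pow] at key
    refine ((ENNReal.pow_le_pow_left_iff two_ne_zero).1 key).trans ?_
    calc _ ≤ K * (C₁ * ‖T s‖ₑ * ‖schwartzSobolev s φ‖ₑ) *
          (C₂ * ‖T t‖ₑ * ‖schwartzSobolev t ψ‖ₑ) := by gcongr
      _ = _ := by ring

/-- Sobolev functions are limits of Schwartz functions, in norm and almost everywhere. -/
lemma exists_schwartz_seq_tendsto {s : ℕ} (u : Sobolev s (⊤ : Opens (Euc n)) ℝ) :
    ∃ φ : ℕ → 𝓢(Euc n, ℝ), Tendsto (fun N => schwartzSobolev s (φ N)) atTop (𝓝 u) ∧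
      ∀ᵐ x ∂(volume : Measure (Euc n)), Tendsto (fun N => φ N x) atTop (𝓝 (u x)) := by
  obtain ⟨v, hv, hlim⟩ := mem_closure_iff_seq_limit.1 (denseRange_schwartzSobolev s u)
  choose φ hφ using hv
  have hlim' : Tendsto (fun N => schwartzSobolev s (φ N)) atTop (𝓝 u) := by simpa only [hφ]
  have hL2 : Tendsto (fun N => schwartzL2 (φ N)) atTop (𝓝 (Sobolev.toL2 u)) :=
    ((Sobolev.toL2CLM (k := s) (Ω := (⊤ : Opens (Euc n))) (V := ℝ)).continuous.tendsto u).comp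
      hlim'
  -- Convergence in `L²` implies convergence in measure, hence almost everywhere along a
  -- subsequence.
  obtain ⟨ns, hns, hae⟩ := (tendstoInMeasure_of_tendsto_Lp hL2).exists_seq_tendsto_ae
  refine ⟨fun N => φ (ns N), hlim'.comp hns.tendsto_atTop, ?_⟩
  filter_upwards [ae_top_iff.1 hae, ae_all_iff.2 fun N => coeFn_schwartzL2 (φ (ns N))] with x hx h2
  simpa only [h2] using hx

/-- The product estimate `‖u v‖₂ ≤ C ‖u‖_{H^s} ‖v‖_{H^t}` for `s + t > n / 2`. -/
lemma exists_eLpNorm_mul_le {s t : ℕ} (h : n < 2 * (s + t)) : ∃ C : ℝ≥0∞, C ≠ ⊤ ∧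
    ∀ (u : Sobolev s (⊤ : Opens (Euc n)) ℝ) (v : Sobolev t (⊤ : Opens (Euc n)) ℝ),
      eLpNorm (fun x => u x * v x) 2 volume ≤ C * ‖u‖ₑ * ‖v‖ₑ := by
  obtain ⟨C, hC, hb⟩ := exists_eLpNorm_mul_schwartz_le h
  refine ⟨C, hC, fun u v => ?_⟩
  obtain ⟨φ, hφ, hφ'⟩ := exists_schwartz_seq_tendsto u
  obtain ⟨ψ, hψ, hψ'⟩ := exists_schwartz_seq_tendsto v
  -- The product `u v` is not yet known to be in `L²`. Fatou's lemma needs only almost everywhere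
  -- convergence of the products and gives the bound as well as the membership.
  refine (Lp.eLpNorm_lim_le_liminf_eLpNorm (f := fun N x => φ N x * ψ N x)
    (fun N => ((φ N).continuous.mul (ψ N).continuous).aestronglyMeasurable) _ ?_).trans ?_
  · filter_upwards [hφ', hψ'] with x h1 h2
    exact h1.mul h2
  · refine (liminf_le_liminf (Eventually.of_forall fun N => hb (φ N) (ψ N))).trans (le_of_eq ?_)
    refine Tendsto.liminf_eq ?_
    have h1 : Tendsto (fun N => ‖schwartzSobolev s (φ N)‖ₑ) atTop (𝓝 ‖u‖ₑ) :=
      (continuous_enorm.tendsto u).comp hφ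
    have h2 : Tendsto (fun N => ‖schwartzSobolev t (ψ N)‖ₑ) atTop (𝓝 ‖v‖ₑ) :=
      (continuous_enorm.tendsto v).comp hψ
    refine ENNReal.Tendsto.mul (ENNReal.Tendsto.const_mul h1 (Or.inr hC)) (Or.inr (by simp)) h2
      (Or.inr (ENNReal.mul_ne_top hC (by simp)))

end Product

end SobolevComp

end

noncomputable section

namespace SobolevComp

open scoped SchwartzMap LineDeriv
open Filter Topology

/-! ### The Leibniz rule and multiplication of Sobolev functions -/

section Pairing

/-- The pairing of two `L²` functions with a bounded weight is jointly continuous. -/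
lemma continuous_integral_mul_mul {α : Type*} [MeasurableSpace α] {μ : Measure α} {g : α → ℝ}
    (hg : AEStronglyMeasurable g μ) {M : ℝ} (hM : ∀ x, |g x| ≤ M) :
    Continuous fun p : Lp ℝ 2 μ × Lp ℝ 2 μ => ∫ x, g x * (p.1 x * p.2 x) ∂μ := by
  have hi : ∀ u v : Lp ℝ 2 μ, Integrable (fun x => u x * v x) μ := fun u v =>
    (Lp.memLp u).integrable_mul (Lp.memLp v)
  have hgi : ∀ u v : Lp ℝ 2 μ, Integrable (fun x => g x * (u x * v x)) μ := fun u v =>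
    (hi u v).bdd_mul hg (Eventually.of_forall hM)
  let B : Lp ℝ 2 μ →ₗ[ℝ] Lp ℝ 2 μ →ₗ[ℝ] ℝ := LinearMap.mk₂ ℝ
    (fun u v => ∫ x, g x * (u x * v x) ∂μ)
    (fun u u' v => by
      rw [← integral_add (hgi u v) (hgi u' v)]
      refine integral_congr_ae ?_
      filter_upwards [Lp.coeFn_add u u'] with x hx
      rw [hx, Pi.add_apply]
      ring)
    (fun c u v => by
      rw [← integral_smul]
      refine integral_congr_ae ?_
      filter_upwards [Lp.coeFn_smul c u] with x hx
      rw [hx, Pi.smul_apply, smul_eq_mul, smul_eq_mul]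
      ring)
    (fun u v v' => by
      rw [← integral_add (hgi u v) (hgi u v')]
      refine integral_congr_ae ?_
      filter_upwards [Lp.coeFn_add v v'] with x hx
      rw [hx, Pi.add_apply]
      ring)
    (fun c u v => by
      rw [← integral_smul]
      refine integral_congr_ae ?_
      filter_upwards [Lp.coeFn_smul c v] with x hx
      rw [hx, Pi.smul_apply, smul_eq_mul, smul_eq_mul]
      ring)
  have hb : ∀ u v, ‖B u v‖ ≤ |M| * ‖u‖ * ‖v‖ := by
    intro u v
    have h1 : ‖B u v‖ ≤ ∫ x, |M| * (‖u x‖ * ‖v x‖) ∂μ := by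
      refine norm_integral_le_of_norm_le ?_ (Eventually.of_forall fun x => ?_)
      · simpa only [norm_mul] using (hi u v).norm.const_mul |M|
      · rw [norm_mul, norm_mul]
        exact mul_le_mul_of_nonneg_right ((hM x).trans (le_abs_self M)) (by positivity)
    have h2 : ∫ x, ‖u x‖ * ‖v x‖ ∂μ ≤ ‖u‖ * ‖v‖ := by
      have h := integral_mul_norm_le_Lp_mul_Lq (μ := μ) (f := u) (g := v)
        Real.HolderConjugate.two_two (by simpa using Lp.memLp u) (by simpa using Lp.memLp v)
      refine h.trans (le_of_eq ?_)
      rw [Lp.norm_def, Lp.norm_def, (Lp.memLp u).eLpNorm_eq_integral_rpow_norm (by simp) (by simp),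
        (Lp.memLp v).eLpNorm_eq_integral_rpow_norm (by simp) (by simp),
        ENNReal.toReal_ofReal (by positivity), ENNReal.toReal_ofReal (by positivity)]
      simp
    rw [integral_const_mul] at h1
    rw [mul_assoc]
    exact h1.trans (mul_le_mul_of_nonneg_left h2 (abs_nonneg M))
  exact (B.mkContinuous₂ |M| hb).continuous₂

variable {n : ℕ}

/-- Integration by parts against a test function. -/
lemma integral_fderiv_test_mul (i : Fin n) (χ : 𝓓((⊤ : Opens (Euc n)), ℝ)) {G : Euc n → ℝ}
    (hG : ContDiff ℝ 1 G) :
    ∫ x, fderiv ℝ χ x (basisVec i) * G x = -∫ x, χ x * fderiv ℝ G x (basisVec i) := by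
  have hχ : ContDiff ℝ 1 χ := χ.contDiff.of_le (by exact_mod_cast le_top)
  have hχ' : Continuous fun x => fderiv ℝ χ x (basisVec i) :=
    (hχ.continuous_fderiv (by simp)).clm_apply continuous_const
  have hχc : HasCompactSupport fun x => fderiv ℝ χ x (basisVec i) :=
    χ.hasCompactSupport.fderiv_apply (𝕜 := ℝ) (basisVec i)
  have hG' : Continuous fun x => fderiv ℝ G x (basisVec i) :=
    (hG.continuous_fderiv (by simp)).clm_apply continuous_const
  rw [integral_mul_fderiv_eq_neg_fderiv_mul_of_integrable (f := χ) (g := G)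
    ((hχ'.mul hG.continuous).integrable_of_hasCompactSupport hχc.mul_right)
    ((χ.continuous.mul hG').integrable_of_hasCompactSupport χ.hasCompactSupport.mul_right)
    ((χ.continuous.mul hG.continuous).integrable_of_hasCompactSupport
      χ.hasCompactSupport.mul_right)
    (fun x _ => hχ.differentiable (by simp) x) (fun x _ => hG.differentiable (by simp) x), neg_neg]

lemma exists_bound_test (χ : 𝓓((⊤ : Opens (Euc n)), ℝ)) : ∃ M, ∀ x, |χ x| ≤ M :=
  χ.hasCompactSupport.exists_bound_of_continuous χ.continuous

lemma exists_bound_fderiv_test (i : Fin n) (χ : 𝓓((⊤ : Opens (Euc n)), ℝ)) :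
    ∃ M, ∀ x, |fderiv ℝ χ x (basisVec i)| ≤ M :=
  (χ.hasCompactSupport.fderiv_apply (𝕜 := ℝ) (basisVec i)).exists_bound_of_continuous
    ((χ.contDiff.continuous_fderiv (by simp)).clm_apply continuous_const)

lemma continuous_fderiv_test (i : Fin n) (χ : 𝓓((⊤ : Opens (Euc n)), ℝ)) :
    Continuous fun x => fderiv ℝ χ x (basisVec i) :=
  (χ.contDiff.continuous_fderiv (by simp)).clm_apply continuous_const

lemma continuous_integral_mul_mul_top {g : Euc n → ℝ} (hg : Continuous g)
    (hM : ∃ M, ∀ x, |g x| ≤ M) :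
    Continuous fun p : L2 (⊤ : Opens (Euc n)) ℝ × L2 (⊤ : Opens (Euc n)) ℝ =>
      ∫ x, g x * (p.1 x * p.2 x) := by
  obtain ⟨M, hM⟩ := hM
  refine (continuous_integral_mul_mul hg.aestronglyMeasurable hM).congr fun p => ?_
  rw [integral_top]

lemma integrable_mul_mul_top {g : Euc n → ℝ} (hg : Continuous g)
    (hM : ∃ M, ∀ x, |g x| ≤ M) (u v : L2 (⊤ : Opens (Euc n)) ℝ) :
    Integrable (fun x => g x * (u x * v x)) volume := by
  obtain ⟨M, hM⟩ := hM
  exact ((memLp_two_top u).integrable_mul (memLp_two_top v)).bdd_mul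
    hg.aestronglyMeasurable (Eventually.of_forall hM)

end Pairing

open Sobolev

variable {n : ℕ}

lemma coeFn_schwartzSobolev (s : ℕ) (φ : 𝓢(Euc n, ℝ)) :
    (schwartzSobolev s φ : Euc n → ℝ) =ᵐ[volume] φ := coeFn_schwartzL2 φ

lemma partialCLM_schwartzSobolev (s : ℕ) (i : Fin n) (φ : 𝓢(Euc n, ℝ)) :
    partialCLM i (schwartzSobolev (s + 1) φ) = schwartzSobolev s (∂_{basisVec i} φ) :=
  partialCLM_eq (isWeakPartial_schwartzL2 i φ)

lemma coeFn_partialCLM_schwartzSobolev (s : ℕ) (i : Fin n) (φ : 𝓢(Euc n, ℝ)) :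
    (partialCLM i (schwartzSobolev (s + 1) φ) : Euc n → ℝ) =ᵐ[volume]
      fun x => fderiv ℝ φ x (basisVec i) := by
  rw [partialCLM_schwartzSobolev]
  exact coeFn_schwartzSobolev s _

/-- The product rule, in integrated form. -/
lemma integral_product_rule {s t : ℕ} (i : Fin n) (χ : 𝓓((⊤ : Opens (Euc n)), ℝ))
    (u : Sobolev (s + 1) (⊤ : Opens (Euc n)) ℝ) (v : Sobolev (t + 1) (⊤ : Opens (Euc n)) ℝ) :
    ∫ x, fderiv ℝ χ x (basisVec i) * (u x * v x) =
      -((∫ x, χ x * (partialCLM i u x * v x)) + ∫ x, χ x * (u x * partialCLM i v x)) := by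
  have h1 := continuous_integral_mul_mul_top (continuous_fderiv_test i χ)
    (exists_bound_fderiv_test i χ)
  have h2 := continuous_integral_mul_mul_top χ.continuous (exists_bound_test χ)
  have cu : Continuous fun p : Sobolev (s + 1) (⊤ : Opens (Euc n)) ℝ ×
      Sobolev (t + 1) (⊤ : Opens (Euc n)) ℝ => toL2 p.1 := toL2CLM.continuous.comp continuous_fst
  have cv : Continuous fun p : Sobolev (s + 1) (⊤ : Opens (Euc n)) ℝ ×
      Sobolev (t + 1) (⊤ : Opens (Euc n)) ℝ => toL2 p.2 := toL2CLM.continuous.comp continuous_snd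
  have cdu : Continuous fun p : Sobolev (s + 1) (⊤ : Opens (Euc n)) ℝ ×
      Sobolev (t + 1) (⊤ : Opens (Euc n)) ℝ => toL2 (partialCLM i p.1) :=
    toL2CLM.continuous.comp ((partialCLM i).continuous.comp continuous_fst)
  have cdv : Continuous fun p : Sobolev (s + 1) (⊤ : Opens (Euc n)) ℝ ×
      Sobolev (t + 1) (⊤ : Opens (Euc n)) ℝ => toL2 (partialCLM i p.2) :=
    toL2CLM.continuous.comp ((partialCLM i).continuous.comp continuous_snd)
  have hd := (denseRange_schwartzSobolev (n := n) (s + 1)).prodMap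
    (denseRange_schwartzSobolev (n := n) (t + 1))
  -- Both sides depend continuously on `(u, v)`, since they are pairings of `L²` functions with
  -- bounded weights. They agree on the dense set of Schwartz pairs by the classical Leibniz rule.
  refine congrFun (hd.equalizer (h1.comp (cu.prodMk cv))
    (((h2.comp (cdu.prodMk cv)).add (h2.comp (cu.prodMk cdv))).neg) ?_) (u, v)
  funext p
  obtain ⟨φ, ψ⟩ := p
  simp only [Function.comp_apply, Prod.map_apply, Pi.neg_apply, Pi.add_apply]
  have hφ := coeFn_schwartzSobolev (s + 1) φ
  have hψ := coeFn_schwartzSobolev (t + 1) ψ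
  have hφ' := coeFn_partialCLM_schwartzSobolev s i φ
  have hψ' := coeFn_partialCLM_schwartzSobolev t i ψ
  rw [← integral_add (integrable_mul_mul_top χ.continuous (exists_bound_test χ) _ _)
    (integrable_mul_mul_top χ.continuous (exists_bound_test χ) _ _)]
  have e1 : ∫ x, fderiv ℝ χ x (basisVec i) *
      (schwartzSobolev (s + 1) φ x * schwartzSobolev (t + 1) ψ x) =
      ∫ x, fderiv ℝ χ x (basisVec i) * (φ x * ψ x) := by
    refine integral_congr_ae ?_
    filter_upwards [hφ, hψ] with x a b
    rw [a, b]
  rw [e1, integral_fderiv_test_mul i χ (G := fun x => φ x * ψ x)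
    ((φ.smooth 1).mul (ψ.smooth 1)), neg_inj]
  refine integral_congr_ae ?_
  filter_upwards [hφ, hψ, hφ', hψ'] with x a b c d
  rw [a, b, c, d, fderiv_fun_mul φ.differentiableAt ψ.differentiableAt]
  simp
  ring

lemma isWeakPartial_mul {s t : ℕ} {i : Fin n}
    {u : Sobolev (s + 1) (⊤ : Opens (Euc n)) ℝ} {v : Sobolev (t + 1) (⊤ : Opens (Euc n)) ℝ}
    {p q : L2 (⊤ : Opens (Euc n)) ℝ} (hp : p =ᵐ[volume] fun x => u x * v x)
    (hq : q =ᵐ[volume] fun x => partialCLM i u x * v x + u x * partialCLM i v x) :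
    IsWeakPartial i p q := by
  refine isWeakPartial_top_iff.2 fun χ => ?_
  have h := integral_product_rule i χ u v
  rw [← integral_add (integrable_mul_mul_top χ.continuous (exists_bound_test χ) _ _)
    (integrable_mul_mul_top χ.continuous (exists_bound_test χ) _ _)] at h
  have e1 : ∫ x, fderiv ℝ χ x (basisVec i) • p x =
      ∫ x, fderiv ℝ χ x (basisVec i) * (u x * v x) := by
    refine integral_congr_ae ?_
    filter_upwards [hp] with x hx
    rw [hx, smul_eq_mul]
  rw [e1, h]
  congr 1
  refine integral_congr_ae ?_
  filter_upwards [hq] with x hx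
  rw [hx, smul_eq_mul, mul_add]

lemma coeFn_add_sobolev {k : ℕ} {Ω : Opens (Euc n)} (u v : Sobolev k Ω ℝ) :
    (u + v : Sobolev k Ω ℝ) =ᵐ[volume.restrict (Ω : Set (Euc n))] fun x => u x + v x := by
  rw [map_add]
  exact Lp.coeFn_add _ _

lemma coeFn_smul_sobolev {k : ℕ} {Ω : Opens (Euc n)} (c : ℝ) (u : Sobolev k Ω ℝ) :
    (c • u : Sobolev k Ω ℝ) =ᵐ[volume.restrict (Ω : Set (Euc n))] fun x => c * u x := by
  rw [map_smul]
  exact Lp.coeFn_smul _ _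

/-- A product estimate gives a bounded bilinear multiplication operator. -/
lemma exists_bilin_of_bound {r s t : ℕ} {C : ℝ}
    (h : ∀ (u : Sobolev s (⊤ : Opens (Euc n)) ℝ) (v : Sobolev t (⊤ : Opens (Euc n)) ℝ),
      ∃ w : Sobolev r (⊤ : Opens (Euc n)) ℝ, (w =ᵐ[volume] fun x => u x * v x) ∧
        ‖w‖ ≤ C * ‖u‖ * ‖v‖) :
    ∃ B : Sobolev s (⊤ : Opens (Euc n)) ℝ →L[ℝ] Sobolev t (⊤ : Opens (Euc n)) ℝ →L[ℝ]
      Sobolev r (⊤ : Opens (Euc n)) ℝ, ∀ u v, B u v =ᵐ[volume] fun x => u x * v x := by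
  -- The product is determined almost everywhere, so the chosen `P` is automatically bilinear.
  choose P hP hPn using h
  have add : ∀ {k : ℕ} (u v : Sobolev k (⊤ : Opens (Euc n)) ℝ),
      (u + v : Sobolev k (⊤ : Opens (Euc n)) ℝ) =ᵐ[volume] fun x => u x + v x :=
    fun u v => ae_top_iff.1 (coeFn_add_sobolev u v)
  have smul : ∀ {k : ℕ} (c : ℝ) (u : Sobolev k (⊤ : Opens (Euc n)) ℝ),
      (c • u : Sobolev k (⊤ : Opens (Euc n)) ℝ) =ᵐ[volume] fun x => c * u x :=
    fun c u => ae_top_iff.1 (coeFn_smul_sobolev c u)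
  let B : Sobolev s (⊤ : Opens (Euc n)) ℝ →ₗ[ℝ] Sobolev t (⊤ : Opens (Euc n)) ℝ →ₗ[ℝ]
      Sobolev r (⊤ : Opens (Euc n)) ℝ := LinearMap.mk₂ ℝ P
    (fun u u' v => ext_ae (ae_top_iff.2 (by
      filter_upwards [hP (u + u') v, hP u v, hP u' v, add u u', add (P u v) (P u' v)]
        with x a b c d e
      rw [a, e, b, c, d]
      ring)))
    (fun c u v => ext_ae (ae_top_iff.2 (by
      filter_upwards [hP (c • u) v, hP u v, smul c u, smul c (P u v)] with x a b d e
      rw [a, e, b, d]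
      ring)))
    (fun u v v' => ext_ae (ae_top_iff.2 (by
      filter_upwards [hP u (v + v'), hP u v, hP u v', add v v', add (P u v) (P u v')]
        with x a b c d e
      rw [a, e, b, c, d]
      ring)))
    (fun c u v => ext_ae (ae_top_iff.2 (by
      filter_upwards [hP u (c • v), hP u v, smul c v, smul c (P u v)] with x a b d e
      rw [a, e, b, d]
      ring)))
  exact ⟨B.mkContinuous₂ C hPn, hP⟩

lemma exists_mul_zero {s t : ℕ} (h : n < 2 * (s + t)) :
    ∃ B : Sobolev s (⊤ : Opens (Euc n)) ℝ →L[ℝ] Sobolev t (⊤ : Opens (Euc n)) ℝ →L[ℝ]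
      Sobolev 0 (⊤ : Opens (Euc n)) ℝ, ∀ u v, B u v =ᵐ[volume] fun x => u x * v x := by
  obtain ⟨C, hC, hb⟩ := exists_eLpNorm_mul_le h
  refine exists_bilin_of_bound (C := Fintype.card (Index 0 n) * C.toReal) fun u v => ?_
  have hm : MemLp (fun x => u x * v x) 2
      (volume.restrict ((⊤ : Opens (Euc n)) : Set (Euc n))) :=
    memLp_top_iff.2 ⟨(memLp_two_top _).1.mul (memLp_two_top _).1,
      (hb u v).trans_lt (ENNReal.mul_lt_top (ENNReal.mul_lt_top hC.lt_top (by simp)) (by simp))⟩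
  refine ⟨ofMem (hm.toLp _) (mem_zero _), ae_top_iff.1 hm.coeFn_toLp, ?_⟩
  refine (norm_zero_order_le _).trans ?_
  rw [toL2_ofMem, Lp.norm_toLp, eLpNorm_top, mul_assoc, mul_assoc]
  refine mul_le_mul_of_nonneg_left ?_ (by positivity)
  have := ENNReal.toReal_mono (ENNReal.mul_ne_top (ENNReal.mul_ne_top hC (by simp)) (by simp))
    (hb u v)
  simpa [mul_assoc] using this

/-- Multiplication `H^s × H^t → H^r` for `r ≤ s, t` and `s + t - r > n / 2`. -/
theorem exists_mul (r : ℕ) : ∀ {s t : ℕ}, r ≤ s → r ≤ t → n + 2 * r < 2 * (s + t) →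
    ∃ B : Sobolev s (⊤ : Opens (Euc n)) ℝ →L[ℝ] Sobolev t (⊤ : Opens (Euc n)) ℝ →L[ℝ]
      Sobolev r (⊤ : Opens (Euc n)) ℝ, ∀ u v, B u v =ᵐ[volume] fun x => u x * v x := by
  induction r with
  | zero => exact fun _ _ h => exists_mul_zero (by omega)
  | succ r ih =>
    intro s t hs ht h
    obtain ⟨s, rfl⟩ : ∃ s', s = s' + 1 := ⟨s - 1, by omega⟩
    obtain ⟨t, rfl⟩ : ∃ t', t = t' + 1 := ⟨t - 1, by omega⟩
    obtain ⟨B₀, h₀⟩ := exists_mul_zero (n := n) (s := s + 1) (t := t + 1) (by omega)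
    -- Each Leibniz term lowers one of `s`, `t` by one. Lowering `r` by one as well leaves `s + t -
    -- r` unchanged, so the induction hypothesis covers both terms.
    obtain ⟨B₁, h₁⟩ := ih (s := s) (t := t + 1) (by omega) (by omega) (by omega)
    obtain ⟨B₂, h₂⟩ := ih (s := s + 1) (t := t) (by omega) (by omega) (by omega)
    let D : ∀ k : ℕ, Fin n → Sobolev (k + 1) (⊤ : Opens (Euc n)) ℝ →L[ℝ]
      Sobolev k (⊤ : Opens (Euc n)) ℝ := fun k i => partialCLM i
    let C : ℝ := Fintype.card (Index (r + 1) n) *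
      (‖B₀‖ + ∑ i, (‖B₁‖ * ‖D s i‖ + ‖B₂‖ * ‖D t i‖))
    refine exists_bilin_of_bound (C := C) fun u v => ?_
    let w : Fin n → Sobolev r (⊤ : Opens (Euc n)) ℝ := fun i =>
      B₁ (partialCLM i u) v + B₂ u (partialCLM i v)
    have hw : ∀ i, IsWeakPartial i (toL2 (B₀ u v)) (toL2 (w i)) := fun i => by
      refine isWeakPartial_mul (h₀ u v) ?_
      filter_upwards [ae_top_iff.1 (coeFn_add_sobolev (B₁ (partialCLM i u) v)
        (B₂ u (partialCLM i v))), h₁ (partialCLM i u) v, h₂ u (partialCLM i v)] with x a b c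
      rw [a, b, c]
    obtain ⟨p, hp, hp'⟩ := exists_succ w hw
    refine ⟨p, by rw [hp]; exact h₀ u v, ?_⟩
    refine (norm_succ_le p).trans ?_
    simp only [C, hp, hp', mul_assoc]
    refine mul_le_mul_of_nonneg_left ?_ (by positivity)
    rw [add_mul, Finset.sum_mul]
    refine add_le_add ?_ (Finset.sum_le_sum fun i _ => ?_)
    · rw [← mul_assoc]
      exact (norm_toL2_le _).trans (B₀.le_opNorm₂ u v)
    · refine (norm_add_le _ _).trans ?_
      rw [add_mul]
      refine add_le_add ?_ ?_
      · refine (B₁.le_opNorm₂ _ _).trans ?_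
        have h1 : ‖partialCLM i u‖ ≤ ‖D s i‖ * ‖u‖ := (D s i).le_opNorm u
        calc _ ≤ ‖B₁‖ * (‖D s i‖ * ‖u‖) * ‖v‖ := by gcongr
          _ = _ := by ring
      · refine (B₂.le_opNorm₂ _ _).trans ?_
        have h1 : ‖partialCLM i v‖ ≤ ‖D t i‖ * ‖v‖ := (D t i).le_opNorm v
        calc _ ≤ ‖B₂‖ * ‖u‖ * (‖D t i‖ * ‖v‖) := by gcongr
          _ = _ := by ring

end SobolevComp

end

noncomputable section

namespace SobolevComp

open scoped SchwartzMap LineDeriv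
open Filter Topology Sobolev

/-! ### Functions with bounded derivatives -/

section BoundedSmooth

variable {d : ℕ}

lemma MemCb.mono {V : Type*} [NormedAddCommGroup V] [NormedSpace ℝ V] {r r' : ℕ} (h : r ≤ r')
    {g : Euc d → V} (hg : MemCb r' g) : MemCb r g :=
  ⟨hg.1.of_le (by exact_mod_cast h), fun j hj => hg.2 j (hj.trans h)⟩

lemma MemCb.comp_clm_sub_const {V W : Type*} [NormedAddCommGroup V] [NormedSpace ℝ V]
    [NormedAddCommGroup W] [NormedSpace ℝ W] {r : ℕ} {g : Euc d → V} (hg : MemCb r g)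
    (L : V →L[ℝ] W) (c : W) : MemCb r fun x => L (g x) - c := by
  have hL : ContDiff ℝ r fun x => L (g x) := L.contDiff.comp hg.1
  refine ⟨hL.sub contDiff_const, fun j hj => ?_⟩
  obtain ⟨C, hC⟩ := hg.2 j hj
  have hjr : ((j : ℕ) : WithTop ℕ∞) ≤ r := by exact_mod_cast hj
  refine ⟨‖L‖ * C + ‖c‖, fun x => ?_⟩
  rw [fun_iteratedFDeriv_sub_apply (hL.of_le hjr).contDiffAt contDiff_const.contDiffAt]
  refine (norm_sub_le _ _).trans (add_le_add ?_ ?_)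
  · exact (L.norm_iteratedFDeriv_comp_left hg.1.contDiffAt hjr).trans
      (mul_le_mul_of_nonneg_left (hC x) (norm_nonneg L))
  · rcases Nat.eq_zero_or_pos j with rfl | hj0
    · rw [norm_iteratedFDeriv_zero]
    · rw [iteratedFDeriv_const_of_ne hj0.ne']
      simp

lemma MemCb.fderiv {V : Type*} [NormedAddCommGroup V] [NormedSpace ℝ V] {r : ℕ} {g : Euc d → V}
    (hg : MemCb (r + 1) g) :
    ContDiff ℝ r (fderiv ℝ g) ∧
      ∀ j ≤ r, ∃ C : ℝ, ∀ x, ‖iteratedFDeriv ℝ j (fderiv ℝ g) x‖ ≤ C := by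
  refine ⟨hg.1.fderiv_right (by norm_cast), fun j hj => ?_⟩
  obtain ⟨C, hC⟩ := hg.2 (j + 1) (by omega)
  exact ⟨C, fun x => by rw [norm_iteratedFDeriv_fderiv]; exact hC x⟩

lemma exists_lipschitzWith {V : Type*} [NormedAddCommGroup V] [NormedSpace ℝ V] {g : Euc d → V}
    (hg : MemCb 1 g) : ∃ K, LipschitzWith K g := by
  obtain ⟨C, hC⟩ := hg.2 1 le_rfl
  refine ⟨C.toNNReal, lipschitzWith_of_nnnorm_fderiv_le (𝕜 := ℝ)
    (hg.1.differentiable (by simp)) fun x => ?_⟩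
  have h := hC x
  rw [norm_iteratedFDeriv_one] at h
  exact NNReal.coe_le_coe.1 (h.trans (Real.le_coe_toNNReal C))

/-- The `l`-th partial derivative of `g`, normalized to vanish at the origin. -/
def partialSub (g : Euc d → ℝ) (l : Fin d) (x : Euc d) : ℝ :=
  fderiv ℝ g x (basisVec l) - fderiv ℝ g 0 (basisVec l)

lemma partialSub_zero (g : Euc d → ℝ) (l : Fin d) : partialSub g l 0 = 0 := sub_self _

lemma memCb_partialSub {r : ℕ} {g : Euc d → ℝ} (hg : MemCb (r + 1) g) (l : Fin d) :
    MemCb r (partialSub g l) :=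
  MemCb.comp_clm_sub_const (g := fderiv ℝ g) hg.fderiv
    (ContinuousLinearMap.apply ℝ ℝ (basisVec l)) _

lemma eq_sum_smul_basisVec (y : Euc d) : y = ∑ l, y l • basisVec l := by
  ext i
  simp [Finset.sum_apply, Pi.single_apply]

/-- On the whole space a nonzero constant is not in `L²` when `n > 0`. Splitting off the value at
the origin leaves coefficients to which superposition results for functions vanishing at `0` apply,
and the constants act by scalar multiplication. -/
lemma fderiv_apply_eq_sum (g : Euc d → ℝ) (x y : Euc d) :
    fderiv ℝ g x y = ∑ l, (partialSub g l x + fderiv ℝ g 0 (basisVec l)) * y l := by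
  conv_lhs => rw [eq_sum_smul_basisVec y]
  rw [map_sum]
  refine Finset.sum_congr rfl fun l _ => ?_
  rw [map_smul, partialSub, sub_add_cancel, smul_eq_mul, mul_comm]

/-- Second order Taylor estimate. -/
lemma exists_taylor_le {g : Euc d → ℝ} (hg : MemCb 2 g) :
    ∃ K : ℝ, 0 ≤ K ∧ ∀ x y : Euc d, |g (x + y) - g x - fderiv ℝ g x y| ≤ K * ‖y‖ ^ 2 := by
  obtain ⟨K, hK⟩ := exists_lipschitzWith (g := fderiv ℝ g) hg.fderiv
  refine ⟨K, K.2, fun x y => ?_⟩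
  -- On the ball of radius `‖y‖` around `x` the derivative differs from the one at `x` by at most `K
  -- * ‖y‖`; the mean value inequality supplies the second factor `‖y‖`.
  have h := (convex_closedBall x ‖y‖).norm_image_sub_le_of_norm_fderiv_le' (𝕜 := ℝ) (f := g)
    (φ := fderiv ℝ g x) (C := K * ‖y‖) (x := x) (y := x + y)
    (fun z _ => hg.1.differentiable (by simp) z) (fun z hz => ?_)
    (Metric.mem_closedBall_self (norm_nonneg y)) (by simp [Metric.mem_closedBall])
  · rw [add_sub_cancel_left] at h
    rw [sq, ← mul_assoc]
    exact h
  · refine (hK.norm_sub_le z x).trans ?_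
    gcongr
    rwa [← mem_closedBall_iff_norm]

end BoundedSmooth

/-! ### Superposition in `L²` and the chain rule -/

section Nemytskii

variable {n d : ℕ}

/-- A tuple of scalar functions as a vector valued function. -/
def tuple (U : Fin d → Euc n → ℝ) (x : Euc n) : Euc d := WithLp.toLp 2 fun l => U l x

@[simp] lemma tuple_apply (U : Fin d → Euc n → ℝ) (x : Euc n) (l : Fin d) :
    tuple U x l = U l x := rfl

/-- A tuple of scalar `L²` functions as a vector valued `L²` function. -/
def joinL2 {Ω : Opens (Euc n)} (U : Fin d → L2 Ω ℝ) : L2 Ω (Euc d) :=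
  ∑ l, (ContinuousLinearMap.toSpanSingleton ℝ (basisVec l)).compLpL 2 _ (U l)

lemma continuous_joinL2 {Ω : Opens (Euc n)} :
    Continuous (joinL2 : (Fin d → L2 Ω ℝ) → L2 Ω (Euc d)) :=
  continuous_finsetSum _ fun l _ =>
    (ContinuousLinearMap.continuous _).comp (continuous_apply l)

lemma coeFn_joinL2 {Ω : Opens (Euc n)} (U : Fin d → L2 Ω ℝ) :
    joinL2 U =ᵐ[volume.restrict (Ω : Set (Euc n))] tuple fun l => U l := by
  refine (Lp.coeFn_finsetSum _ _).trans ?_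
  filter_upwards [ae_all_iff.2 fun l =>
    (ContinuousLinearMap.toSpanSingleton ℝ (basisVec (n := d) l)).coeFn_compLpL (U l)] with x hx
  rw [Finset.sum_apply, eq_sum_smul_basisVec (tuple (fun l => U l) x)]
  refine Finset.sum_congr rfl fun l _ => ?_
  rw [hx l]
  rfl

/-- The superposition operator on `L²` of a Lipschitz function. -/
lemma exists_nemytskii {g : Euc d → ℝ} (hg : MemCb 1 g) (h0 : g 0 = 0) :
    ∃ N : (Fin d → L2 (⊤ : Opens (Euc n)) ℝ) → L2 (⊤ : Opens (Euc n)) ℝ, Continuous N ∧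
      ∀ U, N U =ᵐ[volume] fun x => g (tuple (fun l => U l) x) := by
  obtain ⟨K, hK⟩ := exists_lipschitzWith hg
  refine ⟨fun U => hK.compLp h0 (joinL2 U), (hK.continuous_compLp h0).comp continuous_joinL2,
    fun U => ?_⟩
  filter_upwards [ae_top_iff.1 (hK.coeFn_compLp h0 (joinL2 U)), ae_top_iff.1 (coeFn_joinL2 U)]
    with x h1 h2
  rw [h1, Function.comp_apply, h2]

/-- The chain rule for weak derivatives. -/
lemma isWeakPartial_comp {s : ℕ} {i : Fin n} {g : Euc d → ℝ} (hg : MemCb 2 g) (h0 : g 0 = 0)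
    (U : Fin d → Sobolev (s + 1) (⊤ : Opens (Euc n)) ℝ) {p q : L2 (⊤ : Opens (Euc n)) ℝ}
    (hp : p =ᵐ[volume] fun x => g (tuple (fun l => U l) x))
    (hq : q =ᵐ[volume] fun x => ∑ l, (partialSub g l (tuple (fun l => U l) x) +
      fderiv ℝ g 0 (basisVec l)) * partialCLM i (U l) x) :
    IsWeakPartial i p q := by
  refine isWeakPartial_top_iff.2 fun χ => ?_
  obtain ⟨N, hNc, hN⟩ := exists_nemytskii (n := n) (hg.mono one_le_two) h0
  have hP := fun l => exists_nemytskii (n := n) (memCb_partialSub hg l) (partialSub_zero g l)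
  choose P hPc hP using hP
  have cU : Continuous fun W : Fin d → Sobolev (s + 1) (⊤ : Opens (Euc n)) ℝ =>
      fun l => toL2 (W l) :=
    continuous_pi fun l => toL2CLM.continuous.comp (continuous_apply l)
  have cD : ∀ l, Continuous fun W : Fin d → Sobolev (s + 1) (⊤ : Opens (Euc n)) ℝ =>
      toL2 (partialCLM i (W l)) := fun l =>
    toL2CLM.continuous.comp ((partialCLM i).continuous.comp (continuous_apply l))
  have cT : ∀ {θ : Euc n → ℝ}, Continuous θ → HasCompactSupport θ →
      Continuous fun u : L2 (⊤ : Opens (Euc n)) ℝ => ∫ x, θ x * u x := by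
    intro θ hθ hc
    refine (continuous_integral_smul (V := ℝ)
      (memLp_top_iff.2 (hθ.memLp_of_hasCompactSupport hc (p := 2)))).congr fun u => ?_
    rw [integral_top]
    rfl
  have hχ := exists_bound_test χ
  have iT : ∀ u : L2 (⊤ : Opens (Euc n)) ℝ, Integrable (fun x => χ x * u x) volume := fun u =>
    (χ.continuous.memLp_of_hasCompactSupport χ.hasCompactSupport (p := 2)).integrable_mul
      (memLp_two_top u)
  let c : Fin d → ℝ := fun l => fderiv ℝ g 0 (basisVec l)
  let F : (Fin d → Sobolev (s + 1) (⊤ : Opens (Euc n)) ℝ) → ℝ := fun W =>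
    ∫ x, fderiv ℝ χ x (basisVec i) * N (fun l => toL2 (W l)) x
  let G : (Fin d → Sobolev (s + 1) (⊤ : Opens (Euc n)) ℝ) → ℝ := fun W =>
    -∑ l, ((∫ x, χ x * (P l (fun l => toL2 (W l)) x * toL2 (partialCLM i (W l)) x)) +
      c l * ∫ x, χ x * toL2 (partialCLM i (W l)) x)
  have hF : Continuous F :=
    (cT (continuous_fderiv_test i χ) (χ.hasCompactSupport.fderiv_apply (𝕜 := ℝ) _)).comp
      (hNc.comp cU)
  have hG : Continuous G := by
    refine (continuous_finsetSum _ fun l _ => Continuous.add ?_ (continuous_const.mul ?_)).neg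
    · exact (continuous_integral_mul_mul_top χ.continuous hχ).comp
        (((hPc l).comp cU).prodMk (cD l))
    · exact (cT χ.continuous χ.hasCompactSupport).comp (cD l)
  have hGeq : ∀ W, G W = -∫ x, χ x * ∑ l, (partialSub g l (tuple (fun l => W l) x) + c l) *
      partialCLM i (W l) x := by
    intro W
    have e : ∀ᵐ x ∂(volume : Measure (Euc n)),
        χ x * ∑ l, (partialSub g l (tuple (fun l => W l) x) + c l) * partialCLM i (W l) x =
        ∑ l, (χ x * (P l (fun l => toL2 (W l)) x * toL2 (partialCLM i (W l)) x) +
          c l * (χ x * toL2 (partialCLM i (W l)) x)) := by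
      filter_upwards [ae_all_iff.2 fun l => hP l fun l => toL2 (W l)] with x hx
      rw [Finset.mul_sum]
      refine Finset.sum_congr rfl fun l _ => ?_
      rw [hx l]
      ring
    have i1 := fun l => integrable_mul_mul_top χ.continuous hχ (P l fun l => toL2 (W l))
      (toL2 (partialCLM i (W l)))
    have i2 := fun l => (iT (toL2 (partialCLM i (W l)))).const_mul (c l)
    have i12 : ∀ l, Integrable (fun x => χ x * (P l (fun l => toL2 (W l)) x *
        toL2 (partialCLM i (W l)) x) + c l * (χ x * toL2 (partialCLM i (W l)) x)) volume :=
      fun l => (i1 l).add (i2 l)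
    rw [integral_congr_ae e, integral_finsetSum _ fun l _ => i12 l]
    simp only [G]
    congr 1
    refine Finset.sum_congr rfl fun l _ => ?_
    rw [integral_add (i1 l) (i2 l), integral_const_mul]
  have hd : DenseRange (Pi.map fun _ : Fin d =>
      (schwartzSobolev (s + 1) : 𝓢(Euc n, ℝ) → Sobolev (s + 1) (⊤ : Opens (Euc n)) ℝ)) :=
    DenseRange.piMap fun _ => denseRange_schwartzSobolev (n := n) (s + 1)
  -- Superposition with `g` and with the normalized partial derivatives is `L²`-continuous, so both
  -- sides of the tested chain rule are continuous in the tuple. It then suffices to check Schwartz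
  -- tuples, where the classical chain rule holds.
  have key : F = G := by
    refine hd.equalizer hF hG ?_
    funext φ
    simp only [Function.comp_apply]
    rw [hGeq]
    have hφ := ae_all_iff.2 fun l => coeFn_schwartzSobolev (s + 1) (φ l)
    have hφ' := ae_all_iff.2 fun l => coeFn_partialCLM_schwartzSobolev s i (φ l)
    let Φ : Euc n → Euc d := tuple fun l => φ l
    have hΦ : ∀ x, HasFDerivAt Φ ((EuclideanSpace.equiv (Fin d) ℝ).symm.toContinuousLinearMap.comp
        (ContinuousLinearMap.pi fun l => fderiv ℝ (φ l) x)) x := fun x =>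
      (EuclideanSpace.equiv (Fin d) ℝ).symm.hasFDerivAt.comp x
        (hasFDerivAt_pi.2 fun l => (φ l).hasFDerivAt x)
    have hΦs : ContDiff ℝ 1 Φ :=
      (EuclideanSpace.equiv (Fin d) ℝ).symm.contDiff.comp
        (contDiff_pi.2 fun l => (φ l).smooth 1)
    have hgd : ∀ x, DifferentiableAt ℝ g x := hg.1.differentiable (by simp)
    have e1 : F (Pi.map (fun _ => schwartzSobolev (s + 1)) φ) =
        ∫ x, fderiv ℝ χ x (basisVec i) * g (Φ x) := by
      refine integral_congr_ae ?_
      filter_upwards [hN fun l => toL2 (schwartzSobolev (s + 1) (φ l)), hφ] with x a b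
      simp only [Pi.map_apply]
      rw [a]
      congr 2
      ext l
      exact b l
    rw [e1, integral_fderiv_test_mul i χ (G := fun x => g (Φ x))
      ((hg.1.of_le (by norm_num)).comp hΦs)]
    congr 1
    refine integral_congr_ae ?_
    filter_upwards [hφ, hφ'] with x a b
    have e2 : tuple (fun l => (schwartzSobolev (s + 1) (φ l) : Euc n → ℝ)) x = Φ x := by
      ext l
      exact a l
    simp only [Pi.map_apply]
    have hcomp : HasFDerivAt (fun x => g (Φ x)) ((fderiv ℝ g (Φ x)).comp
        ((EuclideanSpace.equiv (Fin d) ℝ).symm.toContinuousLinearMap.comp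
          (ContinuousLinearMap.pi fun l => fderiv ℝ (φ l) x))) x :=
      (hgd (Φ x)).hasFDerivAt.comp x (hΦ x)
    rw [e2, hcomp.fderiv, ContinuousLinearMap.comp_apply, fderiv_apply_eq_sum]
    congr 1
    refine Finset.sum_congr rfl fun l _ => ?_
    rw [b l]
    rfl
  have h1 : ∫ x, fderiv ℝ χ x (basisVec i) • p x = F U := by
    refine integral_congr_ae ?_
    filter_upwards [hp, hN fun l => toL2 (U l)] with x a b
    rw [a, b, smul_eq_mul]
  rw [h1, key, hGeq]
  congr 1
  refine integral_congr_ae ?_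
  filter_upwards [hq] with x a
  rw [a, smul_eq_mul]

end Nemytskii

/-! ### Continuity of superposition operators -/

section Continuity

variable {n d : ℕ}

lemma coeFn_sum_sobolev {k : ℕ} (w : Fin d → Sobolev k (⊤ : Opens (Euc n)) ℝ) :
    (∑ l, w l : Sobolev k (⊤ : Opens (Euc n)) ℝ) =ᵐ[volume] fun x => ∑ l, w l x := by
  rw [map_sum]
  refine ae_top_iff.1 ((Lp.coeFn_finsetSum _ _).trans (Eventually.of_forall fun x => ?_))
  simp

/-- Superposition operators are continuous from `H^{κ+1}` to `H^j`. -/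
theorem exists_comp_continuous {κ : ℕ} (hκ : n < 2 * κ) (j : ℕ) : j ≤ κ + 1 →
    ∀ g : Euc d → ℝ, MemCb (j + 1) g → g 0 = 0 →
      ∃ Λ : (Fin d → Sobolev (κ + 1) (⊤ : Opens (Euc n)) ℝ) → Sobolev j (⊤ : Opens (Euc n)) ℝ,
        Continuous Λ ∧ ∀ U, Λ U =ᵐ[volume] fun x => g (tuple (fun l => U l) x) := by
  have cU : Continuous fun W : Fin d → Sobolev (κ + 1) (⊤ : Opens (Euc n)) ℝ =>
      fun l => toL2 (W l) :=
    continuous_pi fun l => toL2CLM.continuous.comp (continuous_apply l)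
  induction j with
  | zero =>
    intro _ g hg h0
    obtain ⟨N, hNc, hN⟩ := exists_nemytskii (n := n) hg h0
    exact ⟨fun U => ofMem (N fun l => toL2 (U l)) (mem_zero _),
      continuous_zero_of (hNc.comp cU), fun U => hN _⟩
  | succ j ih =>
    intro hj g hg h0
    have hg2 : MemCb 2 g := hg.mono (by omega)
    obtain ⟨N, hNc, hN⟩ := exists_nemytskii (n := n) (hg2.mono one_le_two) h0
    -- Each step up in the target order costs one derivative of `g`, and the base case needs a
    -- bounded first derivative; hence `j + 1` derivatives for `H^j`.
    have hP := fun l => ih (by omega) (partialSub g l) (memCb_partialSub hg l) (partialSub_zero g l)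
    choose P hPc hP using hP
    -- Multiplication `H^j × H^κ → H^j` requires exactly `n < 2κ`; the second factor will be `∂_i
    -- U_l`, which has lost one order.
    obtain ⟨B, hB⟩ := exists_mul (n := n) j (s := j) (t := κ) le_rfl (by omega) (by omega)
    let w : Fin n → (Fin d → Sobolev (κ + 1) (⊤ : Opens (Euc n)) ℝ) →
        Sobolev j (⊤ : Opens (Euc n)) ℝ := fun i U =>
      ∑ l, (B (P l U) (partialCLM i (U l)) +
        fderiv ℝ g 0 (basisVec l) • incl (by omega : j ≤ κ) (partialCLM i (U l)))
    have hwc : ∀ i, Continuous (w i) := fun i => by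
      refine continuous_finsetSum _ fun l _ => ?_
      have hD : Continuous fun U : Fin d → Sobolev (κ + 1) (⊤ : Opens (Euc n)) ℝ =>
          partialCLM i (U l) := (partialCLM i).continuous.comp (continuous_apply l)
      have hI : Continuous fun U : Fin d → Sobolev (κ + 1) (⊤ : Opens (Euc n)) ℝ =>
          incl (by omega : j ≤ κ) (partialCLM i (U l)) := (incl _).continuous.comp hD
      exact ((B.continuous.comp (hPc l)).clm_apply hD).add (hI.fun_const_smul _)
    have hw : ∀ U i, IsWeakPartial i (N fun l => toL2 (U l)) (toL2 (w i U)) := fun U i => by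
      refine isWeakPartial_comp hg2 h0 U (hN _) ?_
      filter_upwards [coeFn_sum_sobolev fun l => B (P l U) (partialCLM i (U l)) +
          fderiv ℝ g 0 (basisVec l) • incl (by omega : j ≤ κ) (partialCLM i (U l)),
        ae_all_iff.2 fun l => ae_top_iff.1 (coeFn_add_sobolev (B (P l U) (partialCLM i (U l)))
          (fderiv ℝ g 0 (basisVec l) • incl (by omega : j ≤ κ) (partialCLM i (U l)))),
        ae_all_iff.2 fun l => ae_top_iff.1 (coeFn_smul_sobolev (fderiv ℝ g 0 (basisVec l))
          (incl (by omega : j ≤ κ) (partialCLM i (U l)))),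
        ae_all_iff.2 fun l => hB (P l U) (partialCLM i (U l)),
        ae_all_iff.2 fun l => hP l U] with x h1 h2 h3 h4 h5
      refine h1.trans (Finset.sum_congr rfl fun l _ => ?_)
      rw [h2, h3, h4, h5, toL2_incl, add_mul]
    -- The `L²` function and the partial derivatives of `Λ U` are prescribed by maps already known
    -- to be continuous, and these control the `H^{j+1}` norm.
    choose Λ hΛ hΛ' using fun U => exists_succ (fun i => w i U) (hw U)
    refine ⟨Λ, continuous_succ_of ?_ fun i => ?_, fun U => ?_⟩
    · simp only [hΛ]
      exact hNc.comp cU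
    · simp only [hΛ']
      exact hwc i
    · rw [hΛ]
      exact hN _

end Continuity

end SobolevComp

end

/-! ### Differentiability of superposition operators -/

noncomputable section

namespace SobolevComp

open Filter Topology Sobolev

/-- A map is differentiable if it has a continuous candidate derivative which is the derivative
after composition with an injective bounded operator. -/
lemma hasFDerivAt_of_clm_comp {X Y Z : Type*} [NormedAddCommGroup X] [NormedSpace ℝ X]
    [NormedAddCommGroup Y] [NormedSpace ℝ Y] [CompleteSpace Y]
    [NormedAddCommGroup Z] [NormedSpace ℝ Z] [CompleteSpace Z]
    (ι : Y →L[ℝ] Z) (hι : Function.Injective ι) {Λ : X → Y} {A : X → X →L[ℝ] Y}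
    (hA : Continuous A) (hΛ : ∀ u, HasFDerivAt (fun v => ι (Λ v)) (ι.comp (A u)) u) (u : X) :
    HasFDerivAt Λ (A u) u := by
  have hc : ∀ h : X, Continuous fun τ : ℝ => A (u + τ • h) h := fun h =>
    (hA.comp (by fun_prop)).clm_apply continuous_const
  -- The integral exists in `Y` because `A` is continuous and `Y` is complete. The fundamental
  -- theorem of calculus is applied after `ι`, where differentiability is known, and injectivity
  -- brings the identity back to `Y`. Continuity of `A` at `u` then bounds the remainder.
  have e : ∀ h : X, Λ (u + h) - Λ u = ∫ τ in (0 : ℝ)..1, A (u + τ • h) h := by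
    intro h
    refine hι ?_
    have hd : ∀ τ ∈ Set.uIcc (0 : ℝ) 1,
        HasDerivAt (fun τ : ℝ => ι (Λ (u + τ • h))) (ι (A (u + τ • h) h)) τ := fun τ _ => by
      have h1 : HasDerivAt (fun τ : ℝ => u + τ • h) h τ := by
        simpa using ((hasDerivAt_id τ).smul_const h).const_add u
      exact HasFDerivAt.comp_hasDerivAt (l := fun v => ι (Λ v)) τ (hΛ (u + τ • h)) h1
    rw [← ι.intervalIntegral_comp_comm ((hc h).intervalIntegrable _ _),
      intervalIntegral.integral_eq_sub_of_hasDerivAt hd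
        ((ι.continuous.comp (hc h)).intervalIntegrable _ _)]
    simp
  rw [hasFDerivAt_iff_isLittleO_nhds_zero, Asymptotics.isLittleO_iff]
  intro c hc0
  obtain ⟨δ, hδ, hδA⟩ := Metric.continuous_iff.1 hA u c hc0
  filter_upwards [Metric.ball_mem_nhds (0 : X) hδ] with h hh
  have e' : Λ (u + h) - Λ u - A u h = ∫ τ in (0 : ℝ)..1, (A (u + τ • h) h - A u h) := by
    rw [intervalIntegral.integral_sub ((hc h).intervalIntegrable _ _)
      intervalIntegrable_const, ← e]
    simp
  rw [e']
  refine (intervalIntegral.norm_integral_le_of_norm_le_const (C := c * ‖h‖) fun τ hτ => ?_).trans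
    (by simp)
  rw [Set.uIoc_of_le zero_le_one] at hτ
  rw [← sub_apply]
  refine (ContinuousLinearMap.le_opNorm _ _).trans
    (mul_le_mul_of_nonneg_right ?_ (norm_nonneg h))
  rw [← dist_eq_norm]
  refine (hδA _ ?_).le
  rw [dist_eq_norm, add_sub_cancel_left, norm_smul, Real.norm_of_nonneg hτ.1.le]
  exact (mul_le_of_le_one_left (norm_nonneg h) hτ.2).trans_lt (mem_ball_zero_iff.1 hh)

section Smoothness

variable {n d : ℕ}

/-- Superposition operators on `H^{κ+1}` inherit the smoothness of the function. -/
theorem exists_comp_contDiff {κ : ℕ} (hκ : n < 2 * κ) (m : ℕ) :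
    ∀ g : Euc d → ℝ, MemCb (κ + 1 + 1 + m) g → g 0 = 0 →
      ∃ Λ : (Fin d → Sobolev (κ + 1) (⊤ : Opens (Euc n)) ℝ) →
          Sobolev (κ + 1) (⊤ : Opens (Euc n)) ℝ,
        ContDiff ℝ m Λ ∧ ∀ U, Λ U =ᵐ[volume] fun x => g (tuple (fun l => U l) x) := by
  induction m with
  | zero =>
    intro g hg h0
    obtain ⟨Λ, hc, hΛ⟩ := exists_comp_continuous (d := d) hκ (κ + 1) le_rfl g hg h0
    exact ⟨Λ, contDiff_zero.2 hc, hΛ⟩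
  | succ m ih =>
    intro g hg h0
    obtain ⟨Λ, -, hΛ⟩ :=
      exists_comp_continuous (d := d) hκ (κ + 1) le_rfl g (hg.mono (by omega)) h0
    have hP := fun l => ih (partialSub g l) (memCb_partialSub hg l) (partialSub_zero g l)
    choose P hPc hP using hP
    obtain ⟨B, hB⟩ := exists_mul (n := n) (κ + 1) (s := κ + 1) (t := κ + 1) le_rfl le_rfl
      (by omega)
    obtain ⟨K, hK0, hK⟩ := exists_taylor_le (hg.mono (by omega : 2 ≤ κ + 1 + 1 + (m + 1)))
    let c : Fin d → ℝ := fun l => fderiv ℝ g 0 (basisVec l)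
    let A : (Fin d → Sobolev (κ + 1) (⊤ : Opens (Euc n)) ℝ) →
        (Fin d → Sobolev (κ + 1) (⊤ : Opens (Euc n)) ℝ) →L[ℝ]
          Sobolev (κ + 1) (⊤ : Opens (Euc n)) ℝ := fun U =>
      ∑ l, (B (P l U) + c l • ContinuousLinearMap.id ℝ _).comp (ContinuousLinearMap.proj l)
    -- The operator `A U` is built by bounded linear operations from the `P l U`, which are `C^m` in
    -- `U` by the induction hypothesis.
    have hA : ContDiff ℝ m A := ContDiff.sum fun l _ =>
      ((B.contDiff.comp (hPc l)).add contDiff_const).clm_comp contDiff_const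
    have hA' : ∀ U H, A U H =ᵐ[volume] fun x =>
        fderiv ℝ g (tuple (fun l => U l) x) (tuple (fun l => H l) x) := by
      intro U H
      have e : A U H = ∑ l, (B (P l U) (H l) + c l • H l) := by
        simp [A]
      rw [e]
      filter_upwards [coeFn_sum_sobolev fun l => B (P l U) (H l) + c l • H l,
        ae_all_iff.2 fun l => ae_top_iff.1 (coeFn_add_sobolev (B (P l U) (H l)) (c l • H l)),
        ae_all_iff.2 fun l => ae_top_iff.1 (coeFn_smul_sobolev (c l) (H l)),
        ae_all_iff.2 fun l => hB (P l U) (H l), ae_all_iff.2 fun l => hP l U]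
        with x h1 h2 h3 h4 h5
      rw [h1, fderiv_apply_eq_sum]
      refine Finset.sum_congr rfl fun l _ => ?_
      rw [h2, h3, h4, h5, add_mul]
      rfl
    -- The function `Q H` represents `|H|²`, so the algebra property bounds its `L²` norm by `‖H‖²`
    -- without any embedding into bounded functions.
    let Q : (Fin d → Sobolev (κ + 1) (⊤ : Opens (Euc n)) ℝ) →
        Sobolev (κ + 1) (⊤ : Opens (Euc n)) ℝ := fun H => ∑ l, B (H l) (H l)
    have hQ : ∀ H, ‖toL2 (Q H)‖ ≤ d * ‖B‖ * ‖H‖ ^ 2 := by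
      intro H
      refine (norm_toL2_le _).trans ((norm_sum_le _ _).trans ?_)
      refine (Finset.sum_le_card_nsmul _ _ (‖B‖ * ‖H‖ ^ 2) fun l _ => ?_).trans
        (by simp [mul_assoc])
      refine (B.le_opNorm₂ _ _).trans ?_
      rw [sq, ← mul_assoc]
      gcongr <;> exact norm_le_pi_norm H l
    have hR : ∀ U H, ‖toL2 (Λ (U + H)) - toL2 (Λ U) - toL2 (A U H)‖ ≤ K * ‖toL2 (Q H)‖ := by
      intro U H
      refine Lp.norm_le_mul_norm_of_ae_le_mul (ae_top_iff.2 ?_)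
      filter_upwards [ae_top_iff.1 (Lp.coeFn_sub (toL2 (Λ (U + H)) - toL2 (Λ U)) (toL2 (A U H))),
        ae_top_iff.1 (Lp.coeFn_sub (toL2 (Λ (U + H))) (toL2 (Λ U))), hΛ (U + H), hΛ U, hA' U H,
        coeFn_sum_sobolev fun l => B (H l) (H l), ae_all_iff.2 fun l => hB (H l) (H l),
        ae_all_iff.2 fun l => ae_top_iff.1 (coeFn_add_sobolev (U l) (H l))]
        with x h1 h2 h3 h4 h5 h6 h7 h8
      have e1 : tuple (fun l => ((U + H) l : Euc n → ℝ)) x =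
          tuple (fun l => U l) x + tuple (fun l => H l) x := by
        ext l
        exact h8 l
      have e2 : toL2 (Q H) x = ‖tuple (fun l => (H l : Euc n → ℝ)) x‖ ^ 2 := by
        rw [EuclideanSpace.real_norm_sq_eq]
        refine h6.trans (Finset.sum_congr rfl fun l _ => ?_)
        rw [h7, sq]
        rfl
      rw [h1, Pi.sub_apply, h2, Pi.sub_apply, h3, h4, h5, e1, e2, Real.norm_eq_abs,
        Real.norm_of_nonneg (sq_nonneg _)]
      exact hK _ _
    -- The pointwise Taylor remainder is at most `K |H|²`, so the remainder is quadratic in the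
    -- Sobolev norm of `H` when measured in `L²`.
    have hD : ∀ U, HasFDerivAt (fun V => toL2CLM (Λ V)) (toL2CLM.comp (A U)) U := by
      intro U
      rw [hasFDerivAt_iff_isLittleO_nhds_zero]
      refine (Asymptotics.IsBigO.of_bound (K * (d * ‖B‖)) (Eventually.of_forall fun H => ?_)).trans_isLittleO
        (Asymptotics.isLittleO_norm_pow_id one_lt_two)
      refine (hR U H).trans ?_
      rw [norm_pow, norm_norm, mul_assoc]
      exact mul_le_mul_of_nonneg_left (hQ H) hK0
    refine ⟨Λ, ?_, hΛ⟩
    rw [Nat.cast_add, Nat.cast_one, contDiff_succ_iff_hasFDerivAt]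
    exact ⟨A, hA, hasFDerivAt_of_clm_comp toL2CLM toL2_injective hA.continuous hD⟩

end Smoothness

/-! ### Restriction to an open set, and constants -/

section Restriction

variable {n k : ℕ} {Ω : Opens (Euc n)} {V : Type*} [NormedAddCommGroup V] [NormedSpace ℝ V]

/-- Extension of a test function by zero. -/
def extendTest (φ : 𝓓(Ω, ℝ)) : 𝓓((⊤ : Opens (Euc n)), ℝ) :=
  testOfContDiff φ φ.contDiff φ.hasCompactSupport

lemma restrict_le_restrict_top :
    (volume : Measure (Euc n)).restrict (Ω : Set (Euc n)) ≤
      volume.restrict ((⊤ : Opens (Euc n)) : Set (Euc n)) :=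
  Measure.restrict_mono (fun _ _ => trivial) le_rfl

/-- Restriction of `L²` functions to an open set. -/
def restrictL2 (u : L2 (⊤ : Opens (Euc n)) V) : L2 Ω V :=
  ((Lp.memLp u).mono_measure restrict_le_restrict_top).toLp u

lemma coeFn_restrictL2 (u : L2 (⊤ : Opens (Euc n)) V) :
    (restrictL2 u : L2 Ω V) =ᵐ[volume.restrict (Ω : Set (Euc n))] u :=
  MemLp.coeFn_toLp _

lemma ae_restrict_of_ae_top {p : Euc n → Prop}
    (h : ∀ᵐ x ∂volume.restrict ((⊤ : Opens (Euc n)) : Set (Euc n)), p x) :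
    ∀ᵐ x ∂volume.restrict (Ω : Set (Euc n)), p x :=
  ae_mono restrict_le_restrict_top h

lemma norm_restrictL2_le (u : L2 (⊤ : Opens (Euc n)) V) : ‖(restrictL2 u : L2 Ω V)‖ ≤ ‖u‖ := by
  rw [restrictL2, Lp.norm_toLp, Lp.norm_def]
  exact ENNReal.toReal_mono (Lp.memLp u).2.ne (eLpNorm_mono_measure _ restrict_le_restrict_top)

lemma restrictL2_add (u v : L2 (⊤ : Opens (Euc n)) V) :
    (restrictL2 (u + v) : L2 Ω V) = restrictL2 u + restrictL2 v := Lp.ext <| by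
  filter_upwards [coeFn_restrictL2 (Ω := Ω) (u + v), coeFn_restrictL2 (Ω := Ω) u,
    coeFn_restrictL2 (Ω := Ω) v, ae_restrict_of_ae_top (Lp.coeFn_add u v),
    Lp.coeFn_add (restrictL2 u : L2 Ω V) (restrictL2 v)] with x h1 h2 h3 h4 h5
  rw [h1, h5, Pi.add_apply, h2, h3, h4, Pi.add_apply]

lemma restrictL2_smul (c : ℝ) (u : L2 (⊤ : Opens (Euc n)) V) :
    (restrictL2 (c • u) : L2 Ω V) = c • restrictL2 u := Lp.ext <| by
  filter_upwards [coeFn_restrictL2 (Ω := Ω) (c • u), coeFn_restrictL2 (Ω := Ω) u,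
    ae_restrict_of_ae_top (Lp.coeFn_smul c u), Lp.coeFn_smul c (restrictL2 u : L2 Ω V)]
    with x h1 h2 h3 h4
  rw [h1, h4, Pi.smul_apply, h2, h3, Pi.smul_apply]

lemma setIntegral_eq_integral_of_tsupport_subset {θ : Euc n → ℝ} (hθ : tsupport θ ⊆ Ω)
    (F : Euc n → V) : ∫ x in (Ω : Set (Euc n)), θ x • F x = ∫ x, θ x • F x :=
  setIntegral_eq_integral_of_forall_compl_eq_zero fun x hx => by
    rw [image_eq_zero_of_notMem_tsupport (fun hx' => hx (hθ hx')), zero_smul]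

/-- Extension by zero turns a test function on `Ω` into one on the whole space, so the identity on
the whole space already contains the one on `Ω`. -/
lemma IsWeakDeriv.restrict {j : ℕ} {s : Fin j → Fin n} {u w : L2 (⊤ : Opens (Euc n)) V}
    (h : IsWeakDeriv s u w) : IsWeakDeriv s (restrictL2 u : L2 Ω V) (restrictL2 w) := by
  intro φ
  have e : ∀ (θ : 𝓓(Ω, ℝ)) (v : L2 (⊤ : Opens (Euc n)) V),
      ∫ x in (Ω : Set (Euc n)), θ x • (restrictL2 v : L2 Ω V) x =
        ∫ x in ((⊤ : Opens (Euc n)) : Set (Euc n)), θ x • v x := by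
    intro θ v
    rw [integral_top, ← setIntegral_eq_integral_of_tsupport_subset θ.tsupport_subset]
    refine integral_congr_ae ?_
    filter_upwards [coeFn_restrictL2 (Ω := Ω) v] with x hx
    rw [hx]
  exact (e (partialTest s φ) u).trans ((h (extendTest φ)).trans (by rw [e φ w]; rfl))

variable [CompleteSpace V]

/-- Restriction of Sobolev functions to an open set. -/
def restrictCLM : Sobolev k (⊤ : Opens (Euc n)) V →L[ℝ] Sobolev k Ω V :=
  mkCLM
    { toFun := fun u => ofMem (restrictL2 (toL2 u)) fun j hj s => by
        obtain ⟨w, hw⟩ := u.2 j hj s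
        exact ⟨_, hw.restrict⟩
      map_add' := fun u v => toL2_injective (restrictL2_add (toL2 u) (toL2 v))
      map_smul' := fun c u => toL2_injective (restrictL2_smul c (toL2 u)) } 1 fun a u => by
    rw [one_mul, weakDeriv_eq (w := restrictL2 (weakDeriv a u))
      ((isWeakDeriv_weakDeriv a u).restrict)]
    exact (norm_restrictL2_le _).trans (norm_weakDeriv_le a u)

lemma coeFn_restrictCLM (u : Sobolev k (⊤ : Opens (Euc n)) V) :
    (restrictCLM u : Sobolev k Ω V) =ᵐ[volume.restrict (Ω : Set (Euc n))] u :=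
  coeFn_restrictL2 _

/-- The integral of a partial derivative of a test function vanishes, by integration by parts
against the constant `1`. -/
lemma isWeakPartial_one (i : Fin n) {p : L2 Ω ℝ}
    (hp : p =ᵐ[volume.restrict (Ω : Set (Euc n))] fun _ => (1 : ℝ)) : IsWeakPartial i p 0 := by
  intro φ
  have h0 : ∫ x in (Ω : Set (Euc n)), φ x • (0 : L2 Ω ℝ) x = 0 := by
    refine integral_eq_zero_of_ae ?_
    filter_upwards [Lp.coeFn_zero ℝ 2 (volume.restrict (Ω : Set (Euc n)))] with x hx
    rw [hx, Pi.zero_apply, smul_zero]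
  have h1 : ∫ x in (Ω : Set (Euc n)), fderiv ℝ φ x (basisVec i) • p x =
      ∫ x in (Ω : Set (Euc n)), fderiv ℝ φ x (basisVec i) • (1 : ℝ) := by
    refine integral_congr_ae ?_
    filter_upwards [hp] with x hx
    rw [hx]
  have h2 := integral_fderiv_test_mul i (extendTest φ) (G := fun _ => (1 : ℝ)) contDiff_const
  rw [h0, neg_zero, h1, setIntegral_eq_integral_of_tsupport_subset
    ((tsupport_fderiv_apply_subset ℝ _).trans φ.tsupport_subset)]
  refine h2.trans ?_
  simp

/-- Constants belong to the Sobolev spaces of open sets of finite measure. -/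
lemma exists_const_sobolev (hΩ : volume (Ω : Set (Euc n)) ≠ ⊤) (c : V) :
    ∃ C : Sobolev k Ω V, C =ᵐ[volume.restrict (Ω : Set (Euc n))] fun _ => c := by
  have : IsFiniteMeasure (volume.restrict (Ω : Set (Euc n))) :=
    ⟨by rw [Measure.restrict_apply_univ]; exact hΩ.lt_top⟩
  have hm : MemLp (fun _ : Euc n => (1 : ℝ)) 2 (volume.restrict (Ω : Set (Euc n))) := memLp_const 1
  have hk : hm.toLp _ ∈ sobolevSubmodule k Ω ℝ := by
    cases k with
    | zero => exact mem_zero _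
    | succ k => exact mem_succ 0 fun i => isWeakPartial_one i hm.coeFn_toLp
  refine ⟨mapCLM (ContinuousLinearMap.toSpanSingleton ℝ c) (ofMem _ hk), ?_⟩
  filter_upwards [coeFn_mapCLM (ContinuousLinearMap.toSpanSingleton ℝ c) (ofMem _ hk),
    hm.coeFn_toLp] with x h1 h2
  rw [h1, toL2_ofMem, h2]
  simp

lemma coeFn_add_sum_mapCLM (C : Sobolev k Ω (Euc n)) (w : Fin n → Sobolev k Ω ℝ) :
    (C + ∑ l, mapCLM (ContinuousLinearMap.toSpanSingleton ℝ (basisVec l)) (w l) :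
        Sobolev k Ω (Euc n)) =ᵐ[volume.restrict (Ω : Set (Euc n))]
      fun x => C x + ∑ l, w l x • basisVec l := by
  rw [map_add, map_sum]
  filter_upwards [Lp.coeFn_add (toL2 C)
      (∑ l, toL2 (mapCLM (ContinuousLinearMap.toSpanSingleton ℝ (basisVec l)) (w l))),
    Lp.coeFn_finsetSum Finset.univ
      fun l => toL2 (mapCLM (ContinuousLinearMap.toSpanSingleton ℝ (basisVec l)) (w l)),
    ae_all_iff.2 fun l => coeFn_mapCLM (ContinuousLinearMap.toSpanSingleton ℝ (basisVec l)) (w l)]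
    with x h1 h2 h3
  rw [h1, Pi.add_apply, h2, Finset.sum_apply]
  simp only [h3, ContinuousLinearMap.toSpanSingleton_apply]

end Restriction

end SobolevComp

end

/-! ### Transfer to the extension domain -/

open SobolevComp SobolevComp.Sobolev in
theorem mainTheorem10 (n k m : ℕ) (hk : 2 + n / 2 ≤ k) (hm : m ≤ 2)
    (Ω : TopologicalSpace.Opens (SobolevComp.Euc n)) (hΩ : SobolevComp.IsExtensionDomain k Ω)
    (f : SobolevComp.Euc n → SobolevComp.Euc n) (hf : SobolevComp.MemCb (k + 1 + m) f)
    (hf0 : MeasureTheory.volume (Ω : Set (SobolevComp.Euc n)) = ⊤ → f 0 = 0) :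
    ∃ Λ : SobolevComp.Sobolev k Ω (SobolevComp.Euc n) →
        SobolevComp.Sobolev k Ω (SobolevComp.Euc n),
      (∀ u : SobolevComp.Sobolev k Ω (SobolevComp.Euc n),
        (Λ u : SobolevComp.Euc n → SobolevComp.Euc n)
          =ᵐ[MeasureTheory.volume.restrict (Ω : Set (SobolevComp.Euc n))]
            fun x => f ((u : SobolevComp.Euc n → SobolevComp.Euc n) x)) ∧
      ContDiff ℝ m Λ := by
  -- The bound on `k` now reads `κ ≥ 1 + ⌊n/2⌋`, which gives `n < 2κ`.
  obtain ⟨κ, rfl⟩ : ∃ κ, k = κ + 1 := ⟨k - 1, by omega⟩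
  obtain ⟨E, hE⟩ := hΩ
  obtain ⟨C, hC⟩ : ∃ C : Sobolev (κ + 1) Ω (Euc n),
      C =ᵐ[volume.restrict (Ω : Set (Euc n))] fun _ => f 0 := by
    by_cases hv : volume (Ω : Set (Euc n)) = ⊤
    · refine ⟨0, ?_⟩
      rw [hf0 hv, map_zero]
      exact Lp.coeFn_zero _ _ _
    · exact exists_const_sobolev hv _
  have hg := fun l : Fin n => exists_comp_contDiff (n := n) (κ := κ) (by omega) m
    (fun x => EuclideanSpace.proj (𝕜 := ℝ) l (f x) - f 0 l) (hf.comp_clm_sub_const _ _) (sub_self _)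
  choose Φ hΦ hΦ' using hg
  -- The extension operator acts on scalar functions, so it is applied to each component.
  obtain ⟨T, hT⟩ : ∃ T : Sobolev (κ + 1) Ω (Euc n) →L[ℝ]
      (Fin n → Sobolev (κ + 1) (⊤ : Opens (Euc n)) ℝ), ∀ u,
      tuple (fun i => (T u i : Euc n → ℝ)) =ᵐ[volume.restrict (Ω : Set (Euc n))] u := by
    refine ⟨ContinuousLinearMap.pi fun i => E.comp (mapCLM (EuclideanSpace.proj i)), fun u => ?_⟩
    have h : ∀ᵐ x ∂volume.restrict (Ω : Set (Euc n)), ∀ i,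
        (E (mapCLM (EuclideanSpace.proj i) u) : Euc n → ℝ) x = u x i :=
      ae_all_iff.2 fun i => (hE (mapCLM (EuclideanSpace.proj i) u)).trans
        (coeFn_mapCLM (EuclideanSpace.proj (𝕜 := ℝ) i) u)
    refine h.mono fun x hx => ?_
    ext i
    rw [tuple_apply, ← hx i, ContinuousLinearMap.pi_apply, ContinuousLinearMap.comp_apply]
  -- Restriction, reassembly of components and extension are bounded linear, so the smoothness is
  -- that of the `Φ l`; `C` restores the value `f 0` subtracted from `f`.
  refine ⟨fun u => C + ∑ l, mapCLM (ContinuousLinearMap.toSpanSingleton ℝ (basisVec l))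
      (restrictCLM (Φ l (T u))), fun u => ?_,
    contDiff_const.add (ContDiff.sum fun l _ => (mapCLM _).contDiff.comp
      (restrictCLM.contDiff.comp ((hΦ l).comp T.contDiff)))⟩
  refine (coeFn_add_sum_mapCLM C fun l => restrictCLM (Φ l (T u))).trans ?_
  have h5 := ae_all_iff.2 fun l => coeFn_restrictCLM (Ω := Ω) (Φ l (T u))
  have h6 := ae_all_iff.2 fun l => ae_restrict_of_ae (s := (Ω : Set (Euc n))) (hΦ' l (T u))
  filter_upwards [hC, h5, h6, hT u] with x h2 h5 h6 e
  rw [h2, eq_sum_smul_basisVec (f (u x)), eq_sum_smul_basisVec (f 0), ← Finset.sum_add_distrib]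
  refine Finset.sum_congr rfl fun l _ => ?_
  rw [h5, h6, e, ← add_smul, add_sub_cancel]
  rfl
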